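/- Let $A$ be an integral domain with quotient field $K$. Let $\boldsymbol{F}(A)$ be the set of nonzero fractional ideals of $A$, i.e. of nonzero $A$-submodules $E\subseteq K$ such that $dE\subseteq A$ for some $0\ne d\in A$. For $E\in\boldsymbol{F}(A)$ put $E^{-1}=(A:E)=\{y\in K\mid yE\subseteq A\}$ and $E^{v_A}=(E^{-1})^{-1}$. A star operation on $A$ is a map $\star:\boldsymbol{F}(A)\to\boldsymbol{F}(A)$, $E\mapsto E^\star$, such that for all $0\neq x\in K$ and $E,F\in\boldsymbol{F}(A)$: $(xA)^\star=xA$ and $(xE)^\star=xE^\star$; $E\subseteq F$ implies $E^\star\subseteq F^\star$; $E\subseteq E^\star$ and $(E^\star)^\star=E^\star$. Its associated star operation of finite type is $E^{\star_f}=\bigcup\{F^\star\mid F\subseteq E,\ F \text{ a nonzero finitely generated } A\text{-submodule of } K\}$. One says that $A$ is a P$\star$MD (Prüfer $\star$-multiplication domain) if $(II^{-1})^{\star_f}=A$ for every nonzero finitely generated fractional ideal $I$ of $A$. Let $T$ be an integral domain, $M$ a nonzero maximal ideal of $T$, $k=T/M$, $\varphi:T\to k$ the canonical projection, $D$ a proper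 subring of $k$ with quotient field $L\subseteq k$, and $R=\varphi^{-1}(D)$ (a pullback of type $(\square)$). Then $R$ is a domain with the same quotient field $K$ as $T$; write $\varphi$ also for the induced surjection $R\to D$. Let $\ast$ be a star operation on $R$. It induces star operations $\ast_\varphi$ on $D$ and $(\ast)_T$ on $T$, given by $$F^{\ast_\varphi}=\bigcap\left\{\,y\,\varphi\!\left(\left(\varphi^{-1}(y^{-1}F)\right)^{\ast}\right)\ \middle|\ 0\ne y\in L,\ F\subseteq yD\right\}\quad(F\in\boldsymbol{F}(D)),\qquad E^{(\ast)_T}=E^\ast\cap E^{v_T}\quad(E\in\boldsymbol{F}(T)\subseteq\boldsymbol{F}(R)).$$ Then $R$ is a P$\ast$MD if and only if all of the following hold: $k$ is the quotient field of $D$, $D$ is a P$\ast_\varphi$MD, $T$ is a P$(\ast)_T$MD, and $T_M$ is a valuation domain. -/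

import Mathlib

open scoped nonZeroDivisors Pointwise

namespace StarOp

/-- The set of nonzero fractional ideals of the domain `A` with quotient field `K`: the nonzero
`A`-submodules `E` of `K` such that `d E ⊆ A` for some nonzero `d` in `A`. -/
abbrev NzFrac (A : Type*) [CommRing A] (K : Type*) [Field K] [Algebra A K] : Type _ :=
  {E : Submodule A K // E ≠ ⊥ ∧ IsFractional A⁰ E}

namespace NzFrac

section

variable {A : Type*} [CommRing A] {K : Type*} [Field K] [Algebra A K]

theorem exists_ne_zero (E : NzFrac A K) : ∃ x ∈ E.1, x ≠ 0 :=
  Submodule.exists_mem_ne_zero_of_ne_bot E.2.1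

theorem isFractional_of_le {E F : Submodule A K} (h : E ≤ F) (hF : IsFractional A⁰ F) :
    IsFractional A⁰ E := by
  obtain ⟨d, hd, hF⟩ := hF
  exact ⟨d, hd, fun b hb => hF b (h hb)⟩

/-- The fractional ideal `A` itself. -/
def one : NzFrac A K :=
  ⟨1, one_ne_zero, ⟨1, Submonoid.one_mem _, fun b hb => by
    obtain ⟨a, rfl⟩ := Submodule.mem_one.1 hb
    exact ⟨a, by simp⟩⟩⟩

theorem mem_one {x : K} : x ∈ (one : NzFrac A K).1 ↔ ∃ a : A, algebraMap A K a = x :=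
  Submodule.mem_one

theorem exists_fg_of_mem {E : NzFrac A K} {x : K} (hx : x ∈ E.1) :
    ∃ F : NzFrac A K, F.1.FG ∧ F ≤ E ∧ x ∈ F.1 := by
  obtain ⟨e, he, he0⟩ := E.exists_ne_zero
  have hle : Submodule.span A {e, x} ≤ E.1 :=
    Submodule.span_le.2 (by rintro z (rfl | rfl) <;> assumption)
  exact ⟨⟨Submodule.span A {e, x},
    (Submodule.ne_bot_iff _).2 ⟨e, Submodule.subset_span (by simp), he0⟩,
    isFractional_of_le hle E.2.2⟩, Submodule.fg_span (by simp), hle,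
    Submodule.subset_span (by simp)⟩

theorem mem_unit_smul {x : Kˣ} {E : Submodule A K} {z : K} :
    z ∈ x • E ↔ (x : K)⁻¹ * z ∈ E := by
  rw [Units.smul_def, Submodule.mem_smul_pointwise_iff_exists]
  constructor
  · rintro ⟨b, hb, rfl⟩
    simpa using hb
  · intro h
    exact ⟨_, h, by simp⟩

end

section

variable {A : Type*} [CommRing A] [IsDomain A] {K : Type*} [Field K] [Algebra A K]
  [IsFractionRing A K]

/-- The fractional ideal `x E`, for `0 ≠ x ∈ K`. -/
def scale (x : Kˣ) (E : NzFrac A K) : NzFrac A K :=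
  ⟨x • E.1, by
    obtain ⟨e, he, he0⟩ := E.exists_ne_zero
    refine (Submodule.ne_bot_iff _).2 ⟨x * e, mem_unit_smul.2 (by simpa using he), by simp [he0]⟩,
   by
    obtain ⟨d, hd, hE⟩ := E.2.2
    obtain ⟨a, b, hb, hab⟩ := IsFractionRing.div_surjective (A := A) (x : K)
    have hb0 : algebraMap A K b ≠ 0 := IsFractionRing.to_map_ne_zero_of_mem_nonZeroDivisors hb
    refine ⟨b * d, mul_mem hb hd, fun z hz => ?_⟩
    obtain ⟨c, hc⟩ := hE _ (mem_unit_smul.1 hz)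
    refine ⟨a * c, ?_⟩
    have hx : (x : K) ≠ 0 := x.ne_zero
    have ha : algebraMap A K a = x * algebraMap A K b := by rw [← hab]; field_simp
    rw [map_mul, hc, ha, Algebra.smul_def, Algebra.smul_def, map_mul]
    field_simp⟩

theorem mem_scale {x : Kˣ} {E : NzFrac A K} {z : K} :
    z ∈ (scale x E).1 ↔ (x : K)⁻¹ * z ∈ E.1 :=
  mem_unit_smul

theorem scale_scale (x y : Kˣ) (E : NzFrac A K) : scale x (scale y E) = scale (x * y) E :=
  Subtype.ext (smul_smul x y E.1)

theorem scale_one (E : NzFrac A K) : scale 1 E = E :=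
  Subtype.ext (one_smul _ E.1)

theorem scale_mono (x : Kˣ) {E F : NzFrac A K} (h : E ≤ F) : scale x E ≤ scale x F :=
  fun _ hz => mem_scale.2 (h (mem_scale.1 hz))

theorem exists_le_scale_one (E : NzFrac A K) : ∃ x : Kˣ, E ≤ scale x one := by
  obtain ⟨d, hd, hE⟩ := E.2.2
  have hd0 : algebraMap A K d ≠ 0 := IsFractionRing.to_map_ne_zero_of_mem_nonZeroDivisors hd
  refine ⟨(Units.mk0 _ hd0)⁻¹, fun z hz => mem_scale.2 (mem_one.2 ?_)⟩
  obtain ⟨c, hc⟩ := hE z hz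
  exact ⟨c, by rw [hc, Algebra.smul_def]; simp⟩

/-- The product `E F` of fractional ideals. -/
def mul (E F : NzFrac A K) : NzFrac A K :=
  ⟨E.1 * F.1, by
    obtain ⟨e, he, he0⟩ := E.exists_ne_zero
    obtain ⟨f, hf, hf0⟩ := F.exists_ne_zero
    exact (Submodule.ne_bot_iff _).2 ⟨e * f, Submodule.mul_mem_mul he hf, mul_ne_zero he0 hf0⟩,
   E.2.2.mul F.2.2⟩

/-- The inverse `E⁻¹ = (A : E) = {y ∈ K | y E ⊆ A}`. -/
def inv (E : NzFrac A K) : NzFrac A K :=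
  ⟨1 / E.1, by
    obtain ⟨d, hd, hE⟩ := E.2.2
    refine (Submodule.ne_bot_iff _).2 ⟨algebraMap A K d, ?_,
      IsFractionRing.to_map_ne_zero_of_mem_nonZeroDivisors hd⟩
    refine Submodule.mem_div_iff_forall_mul_mem.2 fun y hy => ?_
    obtain ⟨c, hc⟩ := hE y hy
    exact Submodule.mem_one.2 ⟨c, by rw [hc, Algebra.smul_def]⟩,
   (one : NzFrac A K).2.2.div_of_nonzero E.2.2 E.2.1⟩

theorem mem_inv {E : NzFrac A K} {x : K} :
    x ∈ E.inv.1 ↔ ∀ y ∈ E.1, ∃ a : A, algebraMap A K a = x * y := by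
  refine Submodule.mem_div_iff_forall_mul_mem.trans ?_
  simp only [Submodule.mem_one]

/-- The divisorial closure `E^v = (E⁻¹)⁻¹`. -/
def vClosure (E : NzFrac A K) : NzFrac A K := E.inv.inv

theorem inv_anti {E F : NzFrac A K} (h : E ≤ F) : F.inv ≤ E.inv :=
  fun _ hx => mem_inv.2 fun y hy => mem_inv.1 hx y (h hy)

theorem le_vClosure (E : NzFrac A K) : E ≤ E.vClosure :=
  fun x hx => mem_inv.2 fun y hy => by
    obtain ⟨a, ha⟩ := mem_inv.1 hy x hx
    exact ⟨a, by rw [ha, mul_comm]⟩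

theorem vClosure_mono {E F : NzFrac A K} (h : E ≤ F) : E.vClosure ≤ F.vClosure :=
  inv_anti (inv_anti h)

theorem vClosure_idem (E : NzFrac A K) : E.vClosure.vClosure ≤ E.vClosure :=
  inv_anti (le_vClosure E.inv)

theorem inv_scale (x : Kˣ) (E : NzFrac A K) : (scale x E).inv = scale x⁻¹ E.inv := by
  apply Subtype.ext
  ext z
  rw [mem_scale, mem_inv, mem_inv]
  constructor
  · intro h y hy
    obtain ⟨a, ha⟩ := h (x * y) (mem_scale.2 (by simpa using hy))
    exact ⟨a, by rw [ha]; simp; ring⟩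
  · intro h y hy
    obtain ⟨a, ha⟩ := h _ (mem_scale.1 hy)
    refine ⟨a, ?_⟩
    have hx : (x : K) ≠ 0 := x.ne_zero
    rw [ha]
    simp
    field_simp

theorem vClosure_scale (x : Kˣ) (E : NzFrac A K) :
    (scale x E).vClosure = scale x E.vClosure := by
  simp [vClosure, inv_scale]

theorem vClosure_one : (one : NzFrac A K).vClosure = one := by
  apply le_antisymm _ (le_vClosure _)
  intro z hz
  have h1 : (1 : K) ∈ (one : NzFrac A K).inv.1 := by
    refine mem_inv.2 fun y hy => ?_
    obtain ⟨a, ha⟩ := mem_one.1 hy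
    exact ⟨a, by simpa using ha⟩
  obtain ⟨a, ha⟩ := mem_inv.1 hz 1 h1
  exact mem_one.2 ⟨a, by simpa using ha⟩

end

end NzFrac

open NzFrac

/-- A star operation on the domain `A` with quotient field `K`. -/
structure StarOperation (A : Type*) [CommRing A] [IsDomain A] (K : Type*) [Field K] [Algebra A K]
    [IsFractionRing A K] where
  /-- The map `E ↦ E^*` on nonzero fractional ideals. -/
  cl : NzFrac A K → NzFrac A K
  cl_principal : ∀ x : Kˣ, cl (scale x one) = scale x one
  cl_scale : ∀ (x : Kˣ) (E : NzFrac A K), cl (scale x E) = scale x (cl E)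
  cl_mono : ∀ E F : NzFrac A K, E ≤ F → cl E ≤ cl F
  le_cl : ∀ E : NzFrac A K, E ≤ cl E
  cl_idem : ∀ E : NzFrac A K, cl (cl E) = cl E

namespace StarOperation

variable {A : Type*} [CommRing A] [IsDomain A] {K : Type*} [Field K] [Algebra A K]
  [IsFractionRing A K]

theorem cl_one (s : StarOperation A K) : s.cl one = one := by
  simpa [scale_one] using s.cl_principal 1

theorem cl_le_scale_one (s : StarOperation A K) {E : NzFrac A K} {x : Kˣ}
    (h : E ≤ scale x one) : s.cl E ≤ scale x one :=
  (s.cl_mono _ _ h).trans (s.cl_principal x).le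

/-! ### The finite type operation associated to a star operation -/

theorem exists_fg_sup (s : StarOperation A K) {E F G : NzFrac A K}
    (hF : F.1.FG) (hFE : F ≤ E) (hG : G.1.FG) (hGE : G ≤ E) :
    ∃ H : NzFrac A K, H.1.FG ∧ H ≤ E ∧ s.cl F ≤ s.cl H ∧ s.cl G ≤ s.cl H := by
  have hle : F.1 ⊔ G.1 ≤ E.1 := sup_le hFE hGE
  refine ⟨⟨F.1 ⊔ G.1, ne_bot_of_le_ne_bot F.2.1 le_sup_left, F.2.2.sup G.2.2⟩,
    hF.sup hG, hle, s.cl_mono _ _ ?_, s.cl_mono _ _ ?_⟩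
  · exact (le_sup_left : F.1 ≤ F.1 ⊔ G.1)
  · exact (le_sup_right : G.1 ≤ F.1 ⊔ G.1)

/-- The fractional ideal `⋃ {F^* | F ⊆ E, F a nonzero finitely generated submodule of K}`. -/
def finClosure (s : StarOperation A K) (E : NzFrac A K) : NzFrac A K :=
  ⟨{ carrier := {x | ∃ F : NzFrac A K, F.1.FG ∧ F ≤ E ∧ x ∈ (s.cl F).1}
     zero_mem' := by
      obtain ⟨F, hF, hFE, -⟩ := exists_fg_of_mem E.1.zero_mem
      exact ⟨F, hF, hFE, Submodule.zero_mem _⟩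
     add_mem' := by
      rintro x y ⟨F, hF, hFE, hx⟩ ⟨G, hG, hGE, hy⟩
      obtain ⟨H, hH, hHE, h1, h2⟩ := s.exists_fg_sup hF hFE hG hGE
      exact ⟨H, hH, hHE, Submodule.add_mem _ (h1 hx) (h2 hy)⟩
     smul_mem' := by
      rintro a x ⟨F, hF, hFE, hx⟩
      exact ⟨F, hF, hFE, Submodule.smul_mem _ a hx⟩ },
   by
    obtain ⟨e, he, he0⟩ := E.exists_ne_zero
    obtain ⟨F, hF, hFE, heF⟩ := exists_fg_of_mem he
    exact (Submodule.ne_bot_iff _).2 ⟨e, ⟨F, hF, hFE, s.le_cl F heF⟩, he0⟩,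
   isFractional_of_le (by
    rintro x ⟨F, hF, hFE, hx⟩
    exact s.cl_mono _ _ hFE hx) (s.cl E).2.2⟩

theorem mem_finClosure {s : StarOperation A K} {E : NzFrac A K} {x : K} :
    x ∈ (s.finClosure E).1 ↔ ∃ F : NzFrac A K, F.1.FG ∧ F ≤ E ∧ x ∈ (s.cl F).1 :=
  Iff.rfl

theorem le_finClosure (s : StarOperation A K) (E : NzFrac A K) : E ≤ s.finClosure E := by
  intro x hx
  obtain ⟨F, hF, hFE, hxF⟩ := exists_fg_of_mem hx
  exact ⟨F, hF, hFE, s.le_cl F hxF⟩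

theorem finClosure_le_cl (s : StarOperation A K) (E : NzFrac A K) : s.finClosure E ≤ s.cl E := by
  rintro x ⟨F, hF, hFE, hx⟩
  exact s.cl_mono _ _ hFE hx

theorem finClosure_mono (s : StarOperation A K) {E F : NzFrac A K} (h : E ≤ F) :
    s.finClosure E ≤ s.finClosure F := by
  rintro x ⟨G, hG, hGE, hx⟩
  exact ⟨G, hG, hGE.trans h, hx⟩

theorem scale_finClosure_le (s : StarOperation A K) (x : Kˣ) (E : NzFrac A K) :
    scale x (s.finClosure E) ≤ s.finClosure (scale x E) := by
  intro z hz
  obtain ⟨F, hF, hFE, hzF⟩ := mem_scale.1 hz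
  refine ⟨scale x F, ?_, scale_mono x hFE, ?_⟩
  · exact hF.map (DistribSMul.toLinearMap A K x)
  · rw [s.cl_scale]
    exact mem_scale.2 hzF

theorem exists_fg_le_cl (s : StarOperation A K) (E : NzFrac A K) {N : Submodule A K}
    (hN : N.FG) (h : N ≤ (s.finClosure E).1) :
    ∃ F : NzFrac A K, F.1.FG ∧ F ≤ E ∧ N ≤ (s.cl F).1 := by
  induction N, hN using Submodule.fg_induction with
  | singleton x =>
    obtain ⟨F, hF, hFE, hx⟩ := h (Submodule.mem_span_singleton_self x)
    exact ⟨F, hF, hFE, Submodule.span_le.2 (by simpa using hx)⟩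
  | sup N₁ N₂ h1 h2 ih1 ih2 =>
    obtain ⟨F, hF, hFE, hx⟩ := ih1 (le_sup_left.trans h)
    obtain ⟨G, hG, hGE, hy⟩ := ih2 (le_sup_right.trans h)
    obtain ⟨H, hH, hHE, h1, h2⟩ := s.exists_fg_sup hF hFE hG hGE
    exact ⟨H, hH, hHE, sup_le (hx.trans h1) (hy.trans h2)⟩

/-- The star operation of finite type associated to a star operation,
`E ↦ ⋃ {F^* | F ⊆ E, F a nonzero finitely generated submodule of K}`. -/
def finType (s : StarOperation A K) : StarOperation A K where
  cl := s.finClosure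
  cl_principal x := le_antisymm
    ((s.finClosure_le_cl _).trans (s.cl_principal x).le) (s.le_finClosure _)
  cl_scale x E := by
    refine le_antisymm ?_ (s.scale_finClosure_le x E)
    have h := scale_mono x (s.scale_finClosure_le x⁻¹ (scale x E))
    simpa [scale_scale, scale_one] using h
  cl_mono _ _ h := s.finClosure_mono h
  le_cl := s.le_finClosure
  cl_idem E := by
    refine le_antisymm ?_ (s.le_finClosure _)
    rintro x ⟨G, hG, hGE, hx⟩
    obtain ⟨F, hF, hFE, hGF⟩ := s.exists_fg_le_cl E hG hGE
    refine ⟨F, hF, hFE, ?_⟩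
    rw [← s.cl_idem F]
    exact s.cl_mono G (s.cl F) hGF hx

/-- `A` is a Prüfer star multiplication domain with respect to `s`: every nonzero finitely
generated fractional ideal `I` satisfies `(I I⁻¹)^{s_f} = A`. -/
def IsPStarMD (s : StarOperation A K) : Prop :=
  ∀ I : NzFrac A K, I.1.FG → s.finType.cl (I.mul I.inv) = one

/-! ### Projection of a star operation along a surjective homomorphism -/

section Proj

variable {D : Type*} [CommRing D] [IsDomain D] (L : Type*) [Field L] [Algebra D L]
  [IsFractionRing D L]

variable {L} in
/-- The ideal `φ⁻¹(G ∩ D)` of `A`, as a fractional ideal of `A`, for a fractional ideal `G`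
of `D`. It is `φ⁻¹(G)` when `G ⊆ D`. -/
def preimage (K : Type*) [Field K] [Algebra A K] [IsFractionRing A K] (φ : A →+* D)
    (hφ : Function.Surjective φ) (G : NzFrac D L) : NzFrac A K :=
  ⟨IsLocalization.coeSubmodule K (Ideal.comap φ (Submodule.comap (Algebra.linearMap D L) G.1)), by
    obtain ⟨x, hx, hx0⟩ := G.exists_ne_zero
    obtain ⟨a, b, hb, rfl⟩ := IsFractionRing.div_surjective (A := D) x
    have hb0 : algebraMap D L b ≠ 0 := IsFractionRing.to_map_ne_zero_of_mem_nonZeroDivisors hb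
    obtain ⟨r, rfl⟩ := hφ a
    have hr : algebraMap D L (φ r) ∈ G.1 := by
      have := G.1.smul_mem b hx
      rwa [Algebra.smul_def, mul_div_cancel₀ _ hb0] at this
    refine (Submodule.ne_bot_iff _).2 ⟨algebraMap A K r,
      (IsLocalization.mem_coeSubmodule K _).2 ⟨r, hr, rfl⟩, fun h0 => hx0 ?_⟩
    rw [(map_eq_zero_iff _ (IsFractionRing.injective A K)).1 h0]
    simp,
   isFractional_of_le (fun z hz => by
    obtain ⟨a, -, rfl⟩ := (IsLocalization.mem_coeSubmodule K _).1 hz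
    exact mem_one.2 ⟨a, rfl⟩) (one : NzFrac A K).2.2⟩

set_option linter.unusedSectionVars false in
variable {L} in
theorem algebraMap_mem_preimage {φ : A →+* D} {hφ : Function.Surjective φ} {G : NzFrac D L}
    {r : A} : algebraMap A K r ∈ (preimage K φ hφ G).1 ↔ algebraMap D L (φ r) ∈ G.1 := by
  refine (IsLocalization.mem_coeSubmodule K _).trans ⟨?_, fun h => ⟨r, h, rfl⟩⟩
  rintro ⟨a, ha, hab⟩
  rw [← IsFractionRing.injective A K hab]
  exact ha

variable {L} in
theorem preimage_le_iff {φ : A →+* D} {hφ : Function.Surjective φ} {G : NzFrac D L}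
    {E : NzFrac A K} : preimage K φ hφ G ≤ E ↔
      ∀ r : A, algebraMap D L (φ r) ∈ G.1 → algebraMap A K r ∈ E.1 := by
  constructor
  · intro h r hr
    exact h (algebraMap_mem_preimage.2 hr)
  · intro h z hz
    obtain ⟨a, ha, rfl⟩ := (IsLocalization.mem_coeSubmodule K _).1 hz
    exact h a ha

/-- The image `φ(E ∩ A)`, as a `D`-submodule of `L`. It is `φ(E)` when `E ⊆ A`. -/
def image (φ : A →+* D) (E : NzFrac A K) : Submodule D L :=
  IsLocalization.coeSubmodule L (Ideal.map φ (Submodule.comap (Algebra.linearMap A K) E.1))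

set_option linter.unusedSectionVars false in
variable {L} in
theorem mem_image {φ : A →+* D} (hφ : Function.Surjective φ) {E : NzFrac A K} {z : L} :
    z ∈ image L φ E ↔ ∃ r : A, algebraMap A K r ∈ E.1 ∧ algebraMap D L (φ r) = z := by
  refine (IsLocalization.mem_coeSubmodule L _).trans ?_
  simp only [Ideal.mem_map_iff_of_surjective φ hφ]
  constructor
  · rintro ⟨_, ⟨r, hr, rfl⟩, rfl⟩
    exact ⟨r, hr, rfl⟩
  · rintro ⟨r, hr, rfl⟩
    exact ⟨_, ⟨r, hr, rfl⟩, rfl⟩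

variable {L}

/-- The `D`-submodule
`⋂ {y φ((φ⁻¹(y⁻¹ F))^*) | 0 ≠ y ∈ L, F ⊆ y D}` of `L`. -/
def projSubmodule (s : StarOperation A K) (φ : A →+* D) (hφ : Function.Surjective φ)
    (F : NzFrac D L) : Submodule D L :=
  ⨅ (y : Lˣ) (_ : F ≤ scale y one), y • image L φ (s.cl (preimage K φ hφ (scale y⁻¹ F)))

theorem mem_projSubmodule {s : StarOperation A K} {φ : A →+* D} {hφ : Function.Surjective φ}
    {F : NzFrac D L} {z : L} : z ∈ s.projSubmodule φ hφ F ↔ ∀ y : Lˣ, F ≤ scale y one →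
      ∃ r : A, algebraMap A K r ∈ (s.cl (preimage K φ hφ (scale y⁻¹ F))).1 ∧
        algebraMap D L (φ r) = (y : L)⁻¹ * z := by
  simp only [projSubmodule, Submodule.mem_iInf, mem_unit_smul, mem_image hφ]

theorem le_projSubmodule (s : StarOperation A K) (φ : A →+* D) (hφ : Function.Surjective φ)
    (F : NzFrac D L) : F.1 ≤ s.projSubmodule φ hφ F := by
  intro z hz
  refine mem_projSubmodule.2 fun y hy => ?_
  obtain ⟨d, hd⟩ := mem_one.1 (mem_scale.1 (hy hz))
  obtain ⟨r, rfl⟩ := hφ d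
  refine ⟨r, s.le_cl _ (algebraMap_mem_preimage.2 ?_), hd⟩
  rw [hd]
  exact mem_scale.2 (by simpa using hz)

theorem projSubmodule_le (s : StarOperation A K) (φ : A →+* D) (hφ : Function.Surjective φ)
    {F : NzFrac D L} {y : Lˣ} (h : F ≤ scale y one) :
    s.projSubmodule φ hφ F ≤ (scale y (one : NzFrac D L)).1 := by
  intro z hz
  obtain ⟨r, -, hr⟩ := mem_projSubmodule.1 hz y h
  exact mem_scale.2 (mem_one.2 ⟨_, hr⟩)

/-- `s.projSubmodule φ hφ F` as a nonzero fractional ideal of `D`. -/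
def projClosure (s : StarOperation A K) (φ : A →+* D) (hφ : Function.Surjective φ)
    (F : NzFrac D L) : NzFrac D L :=
  ⟨s.projSubmodule φ hφ F, ne_bot_of_le_ne_bot F.2.1 (s.le_projSubmodule φ hφ F), by
    obtain ⟨y, hy⟩ := F.exists_le_scale_one
    exact isFractional_of_le (s.projSubmodule_le φ hφ hy) (scale y one).2.2⟩

theorem scale_projClosure_le (s : StarOperation A K) (φ : A →+* D) (hφ : Function.Surjective φ)
    (x : Lˣ) (F : NzFrac D L) :
    scale x (s.projClosure φ hφ F) ≤ s.projClosure φ hφ (scale x F) := by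
  intro z hz
  refine mem_projSubmodule.2 fun y hy => ?_
  have h1 : F ≤ scale (x⁻¹ * y) one := by
    have := scale_mono x⁻¹ hy
    simpa [scale_scale, scale_one] using this
  obtain ⟨r, hr, hrz⟩ := mem_projSubmodule.1 (mem_scale.1 hz) _ h1
  refine ⟨r, ?_, ?_⟩
  · rw [scale_scale]
    convert hr using 5
    rw [mul_inv, inv_inv, mul_comm]
  · rw [hrz]
    have hx : (x : L) ≠ 0 := x.ne_zero
    push_cast
    field_simp

/-- The projection `s_φ` onto `D` of a star operation `s` on `A` along a surjective homomorphism
`φ : A → D`, given by `F ↦ ⋂ {y φ((φ⁻¹(y⁻¹ F))^s) | 0 ≠ y ∈ L, F ⊆ y D}`. -/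
def proj (s : StarOperation A K) (φ : A →+* D) (hφ : Function.Surjective φ) (L : Type*) [Field L]
    [Algebra D L] [IsFractionRing D L] : StarOperation D L where
  cl := s.projClosure φ hφ
  cl_principal x := le_antisymm (s.projSubmodule_le φ hφ le_rfl) (s.le_projSubmodule φ hφ _)
  cl_scale x F := by
    refine le_antisymm ?_ (s.scale_projClosure_le φ hφ x F)
    have h := scale_mono x (s.scale_projClosure_le φ hφ x⁻¹ (scale x F))
    simpa [scale_scale, scale_one] using h
  cl_mono E F h := by
    intro z hz
    refine mem_projSubmodule.2 fun y hy => ?_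
    obtain ⟨r, hr, hrz⟩ := mem_projSubmodule.1 hz y (h.trans hy)
    refine ⟨r, s.cl_mono _ _ ?_ hr, hrz⟩
    exact preimage_le_iff.2 fun a ha => algebraMap_mem_preimage.2 (scale_mono _ h ha)
  le_cl F := s.le_projSubmodule φ hφ F
  cl_idem F := by
    refine le_antisymm ?_ (s.le_projSubmodule φ hφ _)
    intro z hz
    refine mem_projSubmodule.2 fun y hy => ?_
    obtain ⟨r, hr, hrz⟩ := mem_projSubmodule.1 hz y (s.projSubmodule_le φ hφ hy)
    refine ⟨r, ?_, hrz⟩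
    rw [← s.cl_idem]
    refine s.cl_mono _ _ (preimage_le_iff.2 fun a ha => ?_) hr
    obtain ⟨b, hb, hba⟩ := mem_projSubmodule.1 (mem_scale.1 ha) y hy
    have hφab : φ b = φ a := by
      apply IsFractionRing.injective D L
      rw [hba]
      simp
    have hab : algebraMap A K (a - b) ∈ (s.cl (preimage K φ hφ (scale y⁻¹ F))).1 := by
      refine s.le_cl _ (algebraMap_mem_preimage.2 ?_)
      simp [hφab]
    simpa using Submodule.add_mem _ hab hb

end Proj

/-! ### Extension of a star operation to an overring -/

section Extend

variable {T : Type*} [CommRing T] [IsDomain T] [Algebra A T] [Algebra T K] [IsScalarTower A T K]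
  [IsFractionRing T K]

/-- The conductor `(A : T)` is nonzero: there is `0 ≠ r ∈ A` with `r T ⊆ A`. -/
def ConductorNeZero (A T : Type*) [CommRing A] [CommRing T] [Algebra A T] : Prop :=
  ∃ r : A, r ≠ 0 ∧ ∀ t : T, ∃ a : A, algebraMap A T a = algebraMap A T r * t

/-- A nonzero fractional ideal of `T`, viewed as a nonzero fractional ideal of `A`. -/
def restrict (hT : ConductorNeZero A T) (E : NzFrac T K) : NzFrac A K :=
  ⟨E.1.restrictScalars A, by
    obtain ⟨e, he, he0⟩ := E.exists_ne_zero
    exact (Submodule.ne_bot_iff _).2 ⟨e, he, he0⟩, by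
    obtain ⟨r, hr0, hr⟩ := hT
    obtain ⟨d, hd, hE⟩ := E.2.2
    obtain ⟨c, hc⟩ := hr d
    have hinj : Function.Injective (algebraMap A T) := by
      have h := IsFractionRing.injective A K
      rw [IsScalarTower.algebraMap_eq A T K] at h
      exact Function.Injective.of_comp h
    have hc0 : c ≠ 0 := by
      rintro rfl
      rw [map_zero] at hc
      exact mul_ne_zero ((map_ne_zero_iff _ hinj).2 hr0) (nonZeroDivisors.ne_zero hd) hc.symm
    refine ⟨c, mem_nonZeroDivisors_of_ne_zero hc0, fun b hb => ?_⟩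
    obtain ⟨t, ht⟩ := hE b hb
    obtain ⟨a, ha⟩ := hr t
    refine ⟨a, ?_⟩
    rw [IsScalarTower.algebraMap_apply A T K a, ha, map_mul, ht, Algebra.smul_def,
      Algebra.smul_def, IsScalarTower.algebraMap_apply A T K c, hc, map_mul, mul_assoc]⟩


/-- The fractional ideal `E^s ∩ E^{v_T}` of `T`. -/
def extendClosure (s : StarOperation A K) (hT : ConductorNeZero A T) (E : NzFrac T K) :
    NzFrac T K :=
  ⟨{ carrier := {x | x ∈ (s.cl (restrict hT E)).1 ∧ x ∈ E.vClosure.1}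
     zero_mem' := ⟨Submodule.zero_mem _, Submodule.zero_mem _⟩
     add_mem' := fun hx hy => ⟨Submodule.add_mem _ hx.1 hy.1, Submodule.add_mem _ hx.2 hy.2⟩
     smul_mem' := by
      rintro t x ⟨hx, hxv⟩
      refine ⟨?_, Submodule.smul_mem _ t hxv⟩
      by_cases ht : t = 0
      · rw [ht, zero_smul]
        exact Submodule.zero_mem _
      have ht' : algebraMap T K t ≠ 0 :=
        (map_ne_zero_iff _ (IsFractionRing.injective T K)).2 ht
      have hle : scale (Units.mk0 _ ht') (restrict hT E) ≤ restrict hT E := by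
        intro z hz
        have h := E.1.smul_mem t (mem_scale.1 hz)
        rw [Algebra.smul_def, Units.val_mk0, mul_inv_cancel_left₀ ht'] at h
        exact h
      have h := s.cl_mono _ _ hle
      rw [s.cl_scale] at h
      refine h (mem_scale.2 ?_)
      rw [Algebra.smul_def, Units.val_mk0, inv_mul_cancel_left₀ ht']
      exact hx },
   by
    obtain ⟨e, he, he0⟩ := E.exists_ne_zero
    exact (Submodule.ne_bot_iff _).2
      ⟨e, ⟨s.le_cl (restrict hT E) he, E.le_vClosure he⟩, he0⟩,
   isFractional_of_le (fun x hx => hx.2) E.vClosure.2.2⟩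

theorem mem_extendClosure {s : StarOperation A K} {hT : ConductorNeZero A T} {E : NzFrac T K}
    {x : K} : x ∈ (s.extendClosure hT E).1 ↔ x ∈ (s.cl (restrict hT E)).1 ∧ x ∈ E.vClosure.1 :=
  Iff.rfl

theorem restrict_scale (hT : ConductorNeZero A T) (x : Kˣ) (E : NzFrac T K) :
    restrict (A := A) hT (scale x E) = scale x (restrict hT E) := by
  apply Subtype.ext
  ext z
  rw [mem_scale]
  exact mem_scale

theorem le_extendClosure (s : StarOperation A K) (hT : ConductorNeZero A T) (E : NzFrac T K) :
    E ≤ s.extendClosure hT E :=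
  fun _ hx => ⟨s.le_cl (restrict hT E) hx, E.le_vClosure hx⟩

theorem extendClosure_scale (s : StarOperation A K) (hT : ConductorNeZero A T) (x : Kˣ)
    (E : NzFrac T K) : s.extendClosure hT (scale x E) = scale x (s.extendClosure hT E) := by
  apply Subtype.ext
  ext z
  rw [mem_scale, mem_extendClosure, mem_extendClosure, restrict_scale, s.cl_scale,
    vClosure_scale, mem_scale, mem_scale]

/-- The extension `(s)_T` of a star operation `s` on `A` to an overring `T` of `A` with nonzero
conductor `(A : T)`, given by `E ↦ E^s ∩ E^{v_T}`. -/
def extend (s : StarOperation A K) (T : Type*) [CommRing T] [IsDomain T] [Algebra A T]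
    [Algebra T K] [IsScalarTower A T K] [IsFractionRing T K] (hT : ConductorNeZero A T) :
    StarOperation T K where
  cl := s.extendClosure hT
  cl_principal x := by
    rw [extendClosure_scale]
    congr 1
    refine le_antisymm ?_ (s.le_extendClosure hT _)
    intro z hz
    have h : z ∈ (one : NzFrac T K).vClosure.1 := hz.2
    rwa [vClosure_one] at h
  cl_scale := s.extendClosure_scale hT
  cl_mono E F h := fun _ hx =>
    ⟨s.cl_mono (restrict hT E) (restrict hT F) h hx.1, vClosure_mono h hx.2⟩
  le_cl := s.le_extendClosure hT
  cl_idem E := by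
    refine le_antisymm ?_ (s.le_extendClosure hT _)
    rintro x ⟨hx, hxv⟩
    refine ⟨?_, E.vClosure_idem (vClosure_mono (E := s.extendClosure hT E) (fun _ h => h.2) hxv)⟩
    rw [← s.cl_idem]
    exact s.cl_mono (restrict hT (s.extendClosure hT E)) (s.cl (restrict hT E))
      (fun _ h => h.1) hx

end Extend

end StarOperation

/-! ### The pullback construction -/

section Pullback

variable {T : Type*} [CommRing T] (M : Ideal T) (D : Subring (T ⧸ M))

/-- The ring `R = φ⁻¹(D)`, where `φ : T → T/M` is the canonical projection. -/
def pullbackRing : Subring T := D.comap (Ideal.Quotient.mk M)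

/-- The restriction `φ : R → D` of the canonical projection `φ : T → T/M`. -/
def pullbackProj : pullbackRing M D →+* D :=
  (Ideal.Quotient.mk M).restrict (pullbackRing M D) D fun _ hx => hx

theorem pullbackProj_surjective : Function.Surjective (pullbackProj M D) := by
  rintro ⟨d, hd⟩
  obtain ⟨t, rfl⟩ := Ideal.Quotient.mk_surjective d
  exact ⟨⟨t, hd⟩, rfl⟩

theorem mem_pullbackRing_of_mem {m : T} (hm : m ∈ M) : m ∈ pullbackRing M D := by
  change Ideal.Quotient.mk M m ∈ D
  rw [Ideal.Quotient.eq_zero_iff_mem.2 hm]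
  exact D.zero_mem

theorem pullback_conductorNeZero [hM : NeZero M] :
    StarOperation.ConductorNeZero (pullbackRing M D) T := by
  obtain ⟨m, hm, hm0⟩ := Submodule.exists_mem_ne_zero_of_ne_bot hM.out
  exact ⟨⟨m, mem_pullbackRing_of_mem M D hm⟩, fun h => hm0 (congrArg Subtype.val h),
    fun t => ⟨⟨m * t, mem_pullbackRing_of_mem M D (M.mul_mem_right t hm)⟩, rfl⟩⟩

/-- Since `M ≠ 0`, the rings `R` and `T` have the same quotient field. -/
instance pullbackRing_isFractionRing [IsDomain T] [hM : NeZero M] (K : Type*) [Field K]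
    [Algebra T K] [IsFractionRing T K] : IsFractionRing (pullbackRing M D) K := by
  obtain ⟨m, hm, hm0⟩ := Submodule.exists_mem_ne_zero_of_ne_bot hM.out
  have hinj : Function.Injective (algebraMap (pullbackRing M D) K) := fun a b h =>
    Subtype.ext (IsFractionRing.injective T K h)
  have : FaithfulSMul (pullbackRing M D) K := (faithfulSMul_iff_algebraMap_injective _ _).2 hinj
  refine IsFractionRing.of_field _ K fun z => ?_
  obtain ⟨a, b, hb, rfl⟩ := IsFractionRing.div_surjective (A := T) z
  refine ⟨⟨m * a, mem_pullbackRing_of_mem M D (M.mul_mem_right a hm)⟩,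
    ⟨m * b, mem_pullbackRing_of_mem M D (M.mul_mem_right b hm)⟩, ?_⟩
  have hm1 : algebraMap T K m ≠ 0 := (map_ne_zero_iff _ (IsFractionRing.injective T K)).2 hm0
  change _ = algebraMap T K (m * a) / algebraMap T K (m * b)
  rw [map_mul, map_mul, mul_div_mul_left _ _ hm1]

end Pullback

end StarOp

namespace StarOp

open NzFrac

/-! ### Ideals of denominators. -/

namespace NzFrac

section

variable {A : Type*} [CommRing A] {K : Type*} [Field K] [Algebra A K]

/-! Write Q_A(z) = (A : z) + (A : z⁻¹) for 0 ≠ z ∈ K. As for classical Prüfer domains, invertibility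
of all finitely generated ideals reduces to two generators, so the P⋆MD property says exactly that 1
∈ Q_A(z)^{⋆_f} for all z (`isPStarMD_iff`). Everything then concerns ideals whose closure contains
1, and the working rule is `mem_cl_of_mul_mem`: if 1 ∈ Y^⋆ and aY ⊆ X, then a ∈ X^⋆.

Necessity. Since D ≠ k, an ideal J of R with 1 ∈ J^∗ cannot lie in M: otherwise TJ ⊆ M ⊆ R, which
forces T ⊆ R (`not_le_of_one_mem_cl`). So each Q_R(z) has a generator outside M, and this makes T_M
a valuation domain and k the quotient field of D. Moreover a finitely generated J ⊆ Q_R(z) with 1 ∈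
J^∗ can be transported to φ(J) in D and to TJ in T, keeping 1 in the respective closures
(`one_mem_proj_cl`, `one_mem_extend_cl`).

Sufficiency. Fix z. The condition on T gives an ideal J ⊆ R ∩ Q_T(z) with 1 ∈ J^∗
(`exists_fg_of_one_mem_extend_cl`). The conditions on D, k and T_M give J₂ ⊆ Q_R(z) + M with 1 in
its closure (`exists_one_mem_finType_cl_of_valuationRing`). As M is an ideal of T contained in R, M
Q_T(z) ⊆ Q_R(z). Hence J J₂ ⊆ J Q_R(z) + M Q_T(z) ⊆ Q_R(z), and 1 ∈ Q_R(z)^{∗_f}. -/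

theorem mul_mem_one {x y : K} (hx : x ∈ (one : NzFrac A K).1) (hy : y ∈ (one : NzFrac A K).1) :
    x * y ∈ (one : NzFrac A K).1 := by
  obtain ⟨a, rfl⟩ := mem_one.1 hx
  obtain ⟨b, rfl⟩ := mem_one.1 hy
  exact mem_one.2 ⟨a * b, map_mul _ _ _⟩

theorem one_mul_mem {E : Submodule A K} {x y : K} (hx : x ∈ (one : NzFrac A K).1) (hy : y ∈ E) :
    x * y ∈ E := by
  obtain ⟨a, rfl⟩ := mem_one.1 hx
  rw [← Algebra.smul_def]
  exact E.smul_mem a hy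

theorem eq_one_of_one_mem {E : NzFrac A K} (h : (1 : K) ∈ E.1) (hE : E ≤ one) : E = one :=
  le_antisymm hE fun x hx => by simpa using one_mul_mem hx h

end

section

variable {A : Type*} [CommRing A] [IsDomain A] {K : Type*} [Field K] [Algebra A K]
  [IsFractionRing A K]

/-- For `0 ≠ z ∈ K`, the ideal `(A : z) + (A : z⁻¹)` of `A`. It equals `I I⁻¹` for
`I = A + z A`. -/
def denominators (A : Type*) [CommRing A] [IsDomain A] {K : Type*} [Field K] [Algebra A K]
    [IsFractionRing A K] (z : Kˣ) : NzFrac A K :=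
  ⟨Submodule.span A {x | x ∈ (one : NzFrac A K).1 ∧
      (x * z ∈ (one : NzFrac A K).1 ∨ x * (z : K)⁻¹ ∈ (one : NzFrac A K).1)}, by
    obtain ⟨a, b, hb, hab⟩ := IsFractionRing.div_surjective (A := A) (z : K)
    have hb0 : algebraMap A K b ≠ 0 := IsFractionRing.to_map_ne_zero_of_mem_nonZeroDivisors hb
    refine (Submodule.ne_bot_iff _).2 ⟨algebraMap A K b, Submodule.subset_span
      ⟨mem_one.2 ⟨b, rfl⟩, Or.inl (mem_one.2 ⟨a, ?_⟩)⟩, hb0⟩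
    rw [← hab]
    field_simp,
   isFractional_of_le (Submodule.span_le.2 fun _ hx => hx.1) (one : NzFrac A K).2.2⟩

theorem denominators_le_one (z : Kˣ) : denominators A z ≤ one :=
  Submodule.span_le.2 fun _ hx => hx.1

theorem denominators_inv (z : Kˣ) : denominators A z⁻¹ = denominators A z := by
  refine Subtype.ext (congrArg (Submodule.span A) (Set.ext fun x => ?_))
  simp only [Set.mem_ofPred_eq, Units.val_inv_eq_inv_val, inv_inv, or_comm]

theorem mem_denominators {z : Kˣ} {x : K} (h : x ∈ (one : NzFrac A K).1)
    (hz : x * z ∈ (one : NzFrac A K).1 ∨ x * (z : K)⁻¹ ∈ (one : NzFrac A K).1) :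
    x ∈ (denominators A z).1 :=
  Submodule.subset_span ⟨h, hz⟩

theorem mem_inv_iff {E : NzFrac A K} {x : K} :
    x ∈ E.inv.1 ↔ ∀ y ∈ E.1, x * y ∈ (one : NzFrac A K).1 := by
  simp only [mem_inv, mem_one]

theorem mul_inv_le_one (E : NzFrac A K) : E.mul E.inv ≤ one :=
  Submodule.mul_le.2 fun y hy w hw => by
    rw [mul_comm]
    exact mem_inv_iff.1 hw y hy

end

end NzFrac

/-! ### Star-invertibility tested on ideals of denominators. -/

namespace StarOperation

variable {A : Type*} [CommRing A] [IsDomain A] {K : Type*} [Field K] [Algebra A K]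
  [IsFractionRing A K] {s : StarOperation A K}

/-- For a ≠ 0 one has a ∈ aY^⋆ = (aY)^⋆ ⊆ X^⋆. This replaces the calculus of star products of ideals
throughout. -/
theorem mem_cl_of_mul_mem {X Y : NzFrac A K} (hY : (1 : K) ∈ (s.cl Y).1) {a : K}
    (h : ∀ y ∈ Y.1, a * y ∈ X.1) : a ∈ (s.cl X).1 := by
  by_cases ha : a = 0
  · rw [ha]
    exact Submodule.zero_mem _
  have hle : scale (Units.mk0 a ha) Y ≤ X := fun z hz => by
    have := h _ (mem_scale.1 hz)
    rwa [Units.val_mk0, mul_inv_cancel_left₀ ha] at this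
  refine s.cl_mono _ _ hle ?_
  rw [s.cl_scale]
  exact mem_scale.2 (by simpa [ha] using hY)

theorem mem_one_of_mul_mem {Y : NzFrac A K} (hY : (1 : K) ∈ (s.cl Y).1) {a : K}
    (h : ∀ y ∈ Y.1, a * y ∈ (one : NzFrac A K).1) : a ∈ (one : NzFrac A K).1 := by
  have := mem_cl_of_mul_mem hY h
  rwa [s.cl_one] at this

theorem one_mem_cl_of_le_cl {J X : NzFrac A K} (hJ : (1 : K) ∈ (s.cl J).1) (h : J ≤ s.cl X) :
    (1 : K) ∈ (s.cl X).1 := by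
  rw [← s.cl_idem]
  exact s.cl_mono _ _ h hJ

theorem cl_mul_inv_eq_one_iff {I : NzFrac A K} :
    s.cl (I.mul I.inv) = one ↔ (1 : K) ∈ (s.cl (I.mul I.inv)).1 := by
  refine ⟨fun h => ?_, fun h => eq_one_of_one_mem h ?_⟩
  · rw [h]
    exact mem_one.2 ⟨1, map_one _⟩
  · exact (s.cl_mono _ _ I.mul_inv_le_one).trans s.cl_one.le

/-- If `1` lies in the closure of every ideal `(A : z) + (A : z⁻¹)`, then the sum of two
star-invertible fractional ideals is star-invertible. -/
theorem one_mem_cl_sup_mul_inv (h : ∀ z : Kˣ, (1 : K) ∈ (s.cl (denominators A z)).1)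
    {I₁ I₂ I : NzFrac A K} (hI : I.1 = I₁.1 ⊔ I₂.1)
    (h₁ : (1 : K) ∈ (s.cl (I₁.mul I₁.inv)).1) (h₂ : (1 : K) ∈ (s.cl (I₂.mul I₂.inv)).1) :
    (1 : K) ∈ (s.cl (I.mul I.inv)).1 := by
  refine one_mem_cl_of_le_cl h₁ (Submodule.mul_le.2 fun y₁ hy₁ w₁ hw₁ => ?_)
  rw [← s.cl_idem]
  refine mem_cl_of_mul_mem h₂ fun b hb => ?_
  refine Submodule.mul_induction_on hb (fun y₂ hy₂ w₂ hw₂ => ?_) fun b c hb hc => ?_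
  · rcases eq_or_ne y₁ 0 with rfl | hy₁0
    · simp
    rcases eq_or_ne y₂ 0 with rfl | hy₂0
    · simp
    rw [mem_inv_iff] at hw₁ hw₂
    have hmem : ∀ v : K, (∀ y ∈ I₁.1, v * y ∈ (one : NzFrac A K).1) →
        (∀ y ∈ I₂.1, v * y ∈ (one : NzFrac A K).1) → v ∈ I.inv.1 := fun v hv₁ hv₂ => by
      rw [mem_inv_iff, hI]
      intro y hy
      obtain ⟨a, ha, b, hb, rfl⟩ := Submodule.mem_sup.1 hy
      rw [mul_add]
      exact Submodule.add_mem _ (hv₁ a ha) (hv₂ b hb)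
    have hI₁ : I₁.1 ≤ I.1 := hI ▸ le_sup_left
    have hI₂ : I₂.1 ≤ I.1 := hI ▸ le_sup_right
    -- With this z, a multiplier c ∈ (A : z) puts c w₁ w₂ y₂ into I⁻¹, because c y₂ = (c z) y₁ lets
    -- w₁ absorb y₁ when testing against I₂. Symmetrically c ∈ (A : z⁻¹) puts c w₁ w₂ y₁ into I⁻¹.
    let z : Kˣ := Units.mk0 (y₂ / y₁) (div_ne_zero hy₂0 hy₁0)
    refine mem_cl_of_mul_mem (h z) fun c hc => ?_
    refine Submodule.span_induction (p := fun c _ => y₁ * w₁ * (y₂ * w₂) * c ∈ (I.mul I.inv).1)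
      ?_ (by simp) (fun x y _ _ hx hy => ?_) (fun a x _ hx => ?_) hc
    · rintro c ⟨hc, hcz | hcz⟩
      · have e : y₁ * w₁ * (y₂ * w₂) * c = y₁ * (c * w₁ * (y₂ * w₂)) := by ring
        rw [e]
        refine Submodule.mul_mem_mul (hI₁ hy₁) (hmem _ (fun y hy => ?_) fun y hy => ?_)
        · have := mul_mem_one (mul_mem_one hc (hw₁ y hy)) (hw₂ y₂ hy₂)
          convert this using 1
          ring
        · have := mul_mem_one (mul_mem_one hcz (hw₁ y₁ hy₁)) (hw₂ y hy)
          convert this using 1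
          simp only [z, Units.val_mk0]
          field_simp
      · have e : y₁ * w₁ * (y₂ * w₂) * c = y₂ * (c * w₂ * (y₁ * w₁)) := by ring
        rw [e]
        refine Submodule.mul_mem_mul (hI₂ hy₂) (hmem _ (fun y hy => ?_) fun y hy => ?_)
        · have := mul_mem_one (mul_mem_one hcz (hw₂ y₂ hy₂)) (hw₁ y hy)
          convert this using 1
          simp only [z, Units.val_mk0]
          field_simp
        · have := mul_mem_one (mul_mem_one hc (hw₂ y hy)) (hw₁ y₁ hy₁)
          convert this using 1
          ring
    · rw [mul_add]
      exact Submodule.add_mem _ hx hy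
    · rw [mul_smul_comm]
      exact Submodule.smul_mem _ a hx
  · rw [mul_add]
    exact Submodule.add_mem _ hb hc

/-- Induction on generators: nonzero principal ideals are invertible, and `one_mem_cl_sup_mul_inv`
adds them up. The submodule `N` may become zero during the induction, hence its separation from `I`.
-/
theorem one_mem_cl_mul_inv (h : ∀ z : Kˣ, (1 : K) ∈ (s.cl (denominators A z)).1)
    {N : Submodule A K} (hN : N.FG) :
    ∀ I : NzFrac A K, I.1 = N → (1 : K) ∈ (s.cl (I.mul I.inv)).1 := by
  induction N, hN using Submodule.fg_induction with
  | singleton x =>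
    intro I hI
    have hx : x ≠ 0 := by
      rintro rfl
      exact I.2.1 (by rw [hI, Submodule.span_zero_singleton])
    refine s.le_cl _ ?_
    rw [← mul_inv_cancel₀ hx]
    refine Submodule.mul_mem_mul (hI ▸ Submodule.mem_span_singleton_self x)
      (mem_inv_iff.2 fun y hy => ?_)
    rw [hI] at hy
    obtain ⟨a, rfl⟩ := Submodule.mem_span_singleton.1 hy
    exact mem_one.2 ⟨a, by rw [Algebra.smul_def]; field_simp⟩
  | sup N₁ N₂ h1 h2 ih1 ih2 =>
    intro I hI
    by_cases hb1 : N₁ = ⊥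
    · exact ih2 I (by rw [hI, hb1, bot_sup_eq])
    by_cases hb2 : N₂ = ⊥
    · exact ih1 I (by rw [hI, hb2, sup_bot_eq])
    have hle1 : N₁ ≤ I.1 := hI ▸ le_sup_left
    have hle2 : N₂ ≤ I.1 := hI ▸ le_sup_right
    exact one_mem_cl_sup_mul_inv h (I₁ := ⟨N₁, hb1, isFractional_of_le hle1 I.2.2⟩)
      (I₂ := ⟨N₂, hb2, isFractional_of_le hle2 I.2.2⟩) hI (ih1 _ rfl) (ih2 _ rfl)

/-- An element w of (1, z)⁻¹ lies in (A : z), and then wz lies in (A : z⁻¹). -/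
theorem span_one_mul_inv_le (z : Kˣ) {I : NzFrac A K} (hI : I.1 = Submodule.span A {1, (z : K)}) :
    I.mul I.inv ≤ denominators A z := by
  refine Submodule.mul_le.2 fun y hy w hw => ?_
  have h1 : w ∈ (one : NzFrac A K).1 := by
    simpa using mem_inv_iff.1 hw 1 (hI ▸ Submodule.subset_span (by simp))
  have hz : w * z ∈ (one : NzFrac A K).1 :=
    mem_inv_iff.1 hw z (hI ▸ Submodule.subset_span (by simp))
  rw [hI] at hy
  obtain ⟨a, b, rfl⟩ := Submodule.mem_span_pair.1 hy
  rw [add_mul, smul_mul_assoc, smul_mul_assoc, one_mul, mul_comm (z : K)]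
  refine Submodule.add_mem _ (Submodule.smul_mem _ a (mem_denominators h1 (Or.inl hz)))
    (Submodule.smul_mem _ b (mem_denominators hz (Or.inr ?_)))
  simpa using h1

/-- `A` is a Prüfer star multiplication domain if and only if `(A : z) + (A : z⁻¹)` has closure
`A` with respect to the associated operation of finite type for all `0 ≠ z ∈ K`. -/
theorem isPStarMD_iff :
    s.IsPStarMD ↔ ∀ z : Kˣ, (1 : K) ∈ (s.finType.cl (denominators A z)).1 := by
  refine ⟨fun h z => ?_, fun h I hI => cl_mul_inv_eq_one_iff.2 (one_mem_cl_mul_inv h hI I rfl)⟩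
  -- This serves only to record that z lies in the fractional ideal zA, so that A + zA is
  -- fractional.
  obtain ⟨x, hx⟩ := exists_fg_of_mem (E := scale z (one : NzFrac A K)) (x := (z : K))
    (mem_scale.2 (by simpa using mem_one.2 ⟨1, map_one (algebraMap A K)⟩))
  have hz : Submodule.span A {1, (z : K)} = (one : NzFrac A K).1 ⊔ Submodule.span A {(z : K)} := by
    rw [Submodule.span_insert]
    congr 1
    exact Submodule.one_eq_span.symm
  have hfr : IsFractional A⁰ (Submodule.span A {1, (z : K)}) := by
    rw [hz]
    exact (one : NzFrac A K).2.2.sup (isFractional_of_le (E := Submodule.span A {(z : K)})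
      (F := (scale z (one : NzFrac A K)).1) ((Submodule.span_singleton_le_iff_mem _ _).2
        (hx.2.1 hx.2.2)) (scale z (one : NzFrac A K)).2.2)
  let I : NzFrac A K := ⟨Submodule.span A {1, (z : K)}, (Submodule.ne_bot_iff _).2
    ⟨1, Submodule.subset_span (by simp), one_ne_zero⟩, hfr⟩
  exact s.finType.cl_mono _ _ (span_one_mul_inv_le z rfl)
    (cl_mul_inv_eq_one_iff.1 (h I (Submodule.fg_span (by simp))))

end StarOperation

/-! ### The pullback ring and elements outside M. -/

section Pullback

variable {T : Type*} [CommRing T] {M : Ideal T} {D : Subring (T ⧸ M)}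

theorem mem_pullbackRing_iff_of_sub_mem {a b : T} (h : a - b ∈ M) :
    a ∈ pullbackRing M D ↔ b ∈ pullbackRing M D := by
  change Ideal.Quotient.mk M a ∈ D ↔ Ideal.Quotient.mk M b ∈ D
  rw [Ideal.Quotient.eq.2 h]

theorem exists_notMem_pullbackRing (hD : D ≠ ⊤) : ∃ t : T, t ∉ pullbackRing M D := by
  by_contra! h
  refine hD (eq_top_iff.2 fun x _ => ?_)
  obtain ⟨t, rfl⟩ := Ideal.Quotient.mk_surjective x
  exact h t

theorem pullbackProj_eq_iff {a b : pullbackRing M D} :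
    pullbackProj M D a = pullbackProj M D b ↔ (a : T) - b ∈ M :=
  Subtype.ext_iff.trans Ideal.Quotient.eq

theorem pullbackProj_eq_zero_iff {a : pullbackRing M D} : pullbackProj M D a = 0 ↔ (a : T) ∈ M :=
  Subtype.ext_iff.trans Ideal.Quotient.eq_zero_iff_mem

theorem exists_mul_sub_one_mem [hM : M.IsMaximal] {t : T} (ht : t ∉ M) :
    ∃ u : T, t * u - 1 ∈ M := by
  obtain ⟨u, v, hv, h⟩ := hM.exists_inv ht
  refine ⟨u, ?_⟩
  rw [← h, show t * u - (u * t + v) = -v by ring]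
  exact M.neg_mem hv

theorem notMem_of_sub_one_mem [hM : M.IsMaximal] {t : T} (ht : t - 1 ∈ M) : t ∉ M := fun h =>
  hM.ne_top ((Ideal.eq_top_iff_one M).2 (by simpa using M.sub_mem h ht))

theorem mem_pullbackRing_of_sub_one_mem {t : T} (ht : t - 1 ∈ M) : t ∈ pullbackRing M D :=
  (mem_pullbackRing_iff_of_sub_mem ht).2 (one_mem _)

theorem valuationRing_atPrime_iff [IsDomain T] [M.IsPrime] :
    ValuationRing (Localization.AtPrime M) ↔
      ∀ a b : T, ∃ s : T, s ∉ M ∧ ∃ c : T, s * a = c * b ∨ s * b = c * a := by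
  constructor
  · intro h a b
    obtain ⟨c, hc⟩ := ValuationRing.cond (algebraMap T (Localization.AtPrime M) a)
      (algebraMap T (Localization.AtPrime M) b)
    obtain ⟨c, s, rfl⟩ := IsLocalization.exists_mk'_eq M.primeCompl c
    have hinj := IsLocalization.injective (Localization.AtPrime M) M.primeCompl_le_nonZeroDivisors
    have hcs := IsLocalization.mk'_spec (Localization.AtPrime M) c s
    refine ⟨s, s.2, c, hc.symm.imp (fun hc => hinj ?_) fun hc => hinj ?_⟩
    all_goals
      rw [map_mul, map_mul, ← hcs, ← hc]
      ring
  · intro h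
    refine { cond' := fun x y => ?_ }
    obtain ⟨a, u, rfl⟩ := IsLocalization.exists_mk'_eq M.primeCompl x
    obtain ⟨b, v, rfl⟩ := IsLocalization.exists_mk'_eq M.primeCompl y
    -- The ratio of a/u and b/v is av/(bu), so these are the elements of T to compare.
    obtain ⟨s, hs, c, hc⟩ := h (a * v) (b * u)
    refine ⟨IsLocalization.mk' _ c (⟨s, hs⟩ : M.primeCompl), hc.symm.imp (fun hc => ?_) fun hc => ?_⟩
    all_goals
      rw [← IsLocalization.mk'_mul]
      refine IsLocalization.mk'_eq_of_eq ?_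
      simp only [Submonoid.coe_mul]
      linear_combination hc

variable {K : Type*} [Field K] [Algebra T K] [IsFractionRing T K]

theorem algebraMap_mem_one_pullbackRing {t : T} :
    algebraMap T K t ∈ (one : NzFrac (pullbackRing M D) K).1 ↔ t ∈ pullbackRing M D := by
  refine ⟨fun h => ?_, fun h => NzFrac.mem_one.2 ⟨⟨t, h⟩, rfl⟩⟩
  obtain ⟨r, hr⟩ := NzFrac.mem_one.1 h
  rw [← IsFractionRing.injective T K hr]
  exact r.2

variable [IsDomain T] [NeZero M]

/-- If J were inside M, every t ∈ T would satisfy tJ ⊆ M ⊆ R and so lie in R^∗ = R, contradicting D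
≠ k. -/
theorem not_le_of_one_mem_cl {star : StarOperation (pullbackRing M D) K} (hD : D ≠ ⊤)
    {J : NzFrac (pullbackRing M D) K} (h : (1 : K) ∈ (star.cl J).1) :
    ∃ x ∈ J.1, ∀ m ∈ M, algebraMap T K m ≠ x := by
  by_contra! hcon
  obtain ⟨t, ht⟩ := exists_notMem_pullbackRing hD
  refine ht (algebraMap_mem_one_pullbackRing (K := K).1
    (StarOperation.mem_one_of_mul_mem h fun y hy => ?_))
  obtain ⟨a, ha, rfl⟩ := hcon y hy
  rw [← map_mul]
  exact algebraMap_mem_one_pullbackRing.2 (mem_pullbackRing_of_mem M D (M.mul_mem_left t ha))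

theorem exists_notMem_of_one_mem_cl {star : StarOperation (pullbackRing M D) K} (hD : D ≠ ⊤)
    {J : NzFrac (pullbackRing M D) K} (hJ : J ≤ one) (h : (1 : K) ∈ (star.cl J).1) :
    ∃ r : pullbackRing M D, algebraMap T K r ∈ J.1 ∧ (r : T) ∉ M := by
  obtain ⟨x, hx, hxM⟩ := not_le_of_one_mem_cl hD h
  obtain ⟨r, rfl⟩ := NzFrac.mem_one.1 (hJ hx)
  exact ⟨r, hx, fun hr => hxM r hr rfl⟩

/-- An ideal generated by elements of M stays in M, so some generator of (R : z) + (R : z⁻¹) is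
outside M. -/
theorem exists_denominator_notMem {z : Kˣ} {r : pullbackRing M D}
    (h : algebraMap T K r ∈ (denominators (pullbackRing M D) z).1) (hr : (r : T) ∉ M) :
    ∃ s : pullbackRing M D, (s : T) ∉ M ∧ ∃ c : pullbackRing M D,
      algebraMap T K s * z = algebraMap T K c ∨ algebraMap T K s = algebraMap T K c * z := by
  by_contra! hcon
  have hle : (denominators (pullbackRing M D) z).1 ≤
      (IsLocalization.coeSubmodule K M).restrictScalars (pullbackRing M D) := by
    refine Submodule.span_le.2 ?_
    rintro x ⟨hx, hxz⟩
    obtain ⟨a, rfl⟩ := NzFrac.mem_one.1 hx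
    refine (IsLocalization.mem_coeSubmodule K M).2 ⟨a, ?_, rfl⟩
    by_contra haM
    rcases hxz with hxz | hxz
    · obtain ⟨c, hc⟩ := NzFrac.mem_one.1 hxz
      exact (hcon a haM c).1 hc.symm
    · obtain ⟨c, hc⟩ := NzFrac.mem_one.1 hxz
      refine (hcon a haM c).2 ?_
      change _ = algebraMap (pullbackRing M D) K c * _
      rw [hc, inv_mul_cancel_right₀ z.ne_zero]
      rfl
  obtain ⟨t, ht, h⟩ := (IsLocalization.mem_coeSubmodule K M).1 (hle h)
  rw [IsFractionRing.injective T K h] at ht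
  exact hr ht

/-! ### Necessity: T_M is a valuation domain and k is the quotient field of D. -/

section Forward

variable {star : StarOperation (pullbackRing M D) K}

theorem exists_denominator_of_isPStarMD (hD : D ≠ ⊤) (h : star.IsPStarMD) (z : Kˣ) :
    ∃ s : pullbackRing M D, (s : T) ∉ M ∧ ∃ c : pullbackRing M D,
      algebraMap T K s * z = algebraMap T K c ∨ algebraMap T K s = algebraMap T K c * z := by
  obtain ⟨r, hr, hrM⟩ := exists_notMem_of_one_mem_cl hD (denominators_le_one z)
    (StarOperation.isPStarMD_iff.1 h z)
  exact exists_denominator_notMem hr hrM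

theorem exists_denominator_of_isPStarMD' (hD : D ≠ ⊤) (h : star.IsPStarMD) {a b : T}
    (ha : a ≠ 0) (hb : b ≠ 0) : ∃ s : pullbackRing M D, (s : T) ∉ M ∧ ∃ c : pullbackRing M D,
      (s : T) * a = c * b ∨ (s : T) * b = c * a := by
  have hinj := IsFractionRing.injective T K
  have ha' : algebraMap T K a ≠ 0 := (map_ne_zero_iff _ hinj).2 ha
  have hb' : algebraMap T K b ≠ 0 := (map_ne_zero_iff _ hinj).2 hb
  obtain ⟨s, hs, c, hc⟩ := exists_denominator_of_isPStarMD hD h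
    (Units.mk0 (algebraMap T K a / algebraMap T K b) (div_ne_zero ha' hb'))
  rw [Units.val_mk0] at hc
  refine ⟨s, hs, c, hc.imp (fun hc => hinj ?_) fun hc => hinj ?_⟩
  all_goals
    field_simp at hc
    rw [map_mul, map_mul, hc]
    try ring

theorem valuationRing_of_isPStarMD [M.IsMaximal] (hD : D ≠ ⊤) (h : star.IsPStarMD) :
    ValuationRing (Localization.AtPrime M) := by
  refine valuationRing_atPrime_iff.2 fun a b => ?_
  by_cases ha : a = 0
  · exact ⟨1, notMem_of_sub_one_mem (by simp), 0, Or.inl (by simp [ha])⟩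
  by_cases hb : b = 0
  · exact ⟨1, notMem_of_sub_one_mem (by simp), 0, Or.inr (by simp [hb])⟩
  obtain ⟨s, hs, c, hc⟩ := exists_denominator_of_isPStarMD' hD h ha hb
  exact ⟨s, hs, c, hc⟩

theorem isFractionRing_of_isPStarMD [M.IsMaximal] (hD : D ≠ ⊤) (h : star.IsPStarMD) :
    IsFractionRing D (T ⧸ M) := by
  let := Ideal.Quotient.field M
  refine IsFractionRing.of_field D (T ⧸ M) fun z => ?_
  obtain ⟨t, rfl⟩ := Ideal.Quotient.mk_surjective z
  by_cases ht : t ∈ M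
  · exact ⟨0, 1, by simp [Ideal.Quotient.eq_zero_iff_mem.2 ht]⟩
  -- Comparing t with 1 gives st = c or s = ct with s, c ∈ R and s ∉ M; reducing modulo M writes the
  -- class of t as a fraction over D.
  obtain ⟨s, hs, c, hc⟩ := exists_denominator_of_isPStarMD' hD h
    (show t ≠ 0 from fun h0 => ht (h0 ▸ M.zero_mem)) one_ne_zero
  have hs0 : Ideal.Quotient.mk M s ≠ 0 := mt Ideal.Quotient.eq_zero_iff_mem.1 hs
  rcases hc with hc | hc
  · refine ⟨pullbackProj M D c, pullbackProj M D s, ?_⟩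
    change _ = Ideal.Quotient.mk M c / Ideal.Quotient.mk M s
    rw [eq_div_iff hs0, mul_comm, ← map_mul, hc, mul_one]
  · refine ⟨pullbackProj M D s, pullbackProj M D c, ?_⟩
    change _ = Ideal.Quotient.mk M s / Ideal.Quotient.mk M c
    rw [mul_one] at hc
    have hc0 : Ideal.Quotient.mk M c ≠ 0 := fun h0 => hs0 (by rw [hc, map_mul, h0, zero_mul])
    rw [eq_div_iff hc0, mul_comm, ← map_mul, hc]

end Forward

end Pullback

/-! ### Necessity: passage from R to D and to T. -/

section Image

variable {A : Type*} [CommRing A] {K : Type*} [Field K] [Algebra A K]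
  [IsFractionRing A K] {D : Type*} [CommRing D] (L : Type*) [Field L] [Algebra D L]

theorem image_fg {φ : A →+* D} {E : NzFrac A K} (hE : E ≤ one) (hfg : E.1.FG) :
    (StarOperation.image L φ E).FG := by
  refine Submodule.FG.map _ (Ideal.FG.map ?_ φ)
  refine Submodule.fg_of_fg_map_injective (Algebra.linearMap A K) (IsFractionRing.injective A K) ?_
  rwa [Submodule.map_comap_eq_of_le]
  intro x hx
  obtain ⟨a, rfl⟩ := NzFrac.mem_one.1 (hE hx)
  exact ⟨a, rfl⟩

end Image

section Pullback

variable {T : Type*} [CommRing T] [IsDomain T] {K : Type*} [Field K] [Algebra T K]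
  [IsFractionRing T K] {M : Ideal T} [NeZero M] {D : Subring (T ⧸ M)}
  {L : Type*} [Field L] [Algebra D L] [IsFractionRing D L]
  {star : StarOperation (pullbackRing M D) K}

theorem denominators_subset (z : Kˣ) :
    ((denominators (pullbackRing M D) z).1 : Set K) ⊆ (denominators T z).1 := by
  have hone : ∀ x : K, x ∈ (one : NzFrac (pullbackRing M D) K).1 → x ∈ (one : NzFrac T K).1 := by
    intro x hx
    obtain ⟨r, rfl⟩ := NzFrac.mem_one.1 hx
    exact NzFrac.mem_one.2 ⟨r, rfl⟩
  change (denominators (pullbackRing M D) z).1 ≤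
    (denominators T z).1.restrictScalars (pullbackRing M D)
  refine Submodule.span_le.2 ?_
  rintro x ⟨hx, hxz⟩
  exact mem_denominators (hone _ hx) (hxz.imp (hone _) (hone _))

variable [M.IsMaximal]

/-- The point is that each y⁻¹ occurring in the intersection belongs to D and has a lift in the
closure of φ⁻¹(y⁻¹F). A candidate lift is built in T; multiplying it by J lands in φ⁻¹(y⁻¹F), so it
lies in that closure, which is contained in R. -/
theorem one_mem_proj_cl {J : NzFrac (pullbackRing M D) K} (hJ : J ≤ one)
    (h : (1 : K) ∈ (star.cl J).1) {F : NzFrac D L}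
    (hF : ∀ r : pullbackRing M D, algebraMap T K r ∈ J.1 →
      algebraMap D L (pullbackProj M D r) ∈ F.1) :
    (1 : L) ∈ ((star.proj (pullbackProj M D) (pullbackProj_surjective M D) L).cl F).1 := by
  refine StarOperation.mem_projSubmodule.2 fun y hy => ?_
  obtain ⟨c, d, hd, hcd⟩ := IsFractionRing.div_surjective (A := D) (y : L)⁻¹
  obtain ⟨c, rfl⟩ := pullbackProj_surjective M D c
  obtain ⟨d, rfl⟩ := pullbackProj_surjective M D d
  have hd0 := nonZeroDivisors.ne_zero hd
  have hd0' : algebraMap D L (pullbackProj M D d) ≠ 0 :=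
    IsFractionRing.to_map_ne_zero_of_mem_nonZeroDivisors hd
  -- With u inverse to d modulo M, the element cu of T represents y⁻¹ = φ(c)/φ(d). `hlift` expresses
  -- this without embedding L in k.
  obtain ⟨u, hu⟩ := exists_mul_sub_one_mem (mt pullbackProj_eq_zero_iff.2 hd0)
  have hlift : ∀ (r s : pullbackRing M D),
      algebraMap D L (pullbackProj M D s) = (y : L)⁻¹ * algebraMap D L (pullbackProj M D r) ↔
        c * u * r - (s : T) ∈ M := by
    intro r s
    rw [← hcd, div_mul_eq_mul_div, eq_div_iff hd0', ← map_mul, ← map_mul, ← map_mul, ← map_mul,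
      (IsFractionRing.injective D L).eq_iff, pullbackProj_eq_iff]
    push_cast
    constructor
    · intro hm
      have := M.add_mem (M.mul_mem_left (-u) hm) (M.mul_mem_left (s : T) hu)
      convert this using 1
      ring
    · intro hm
      have := M.sub_mem (M.mul_mem_left (c * r : T) hu) (M.mul_mem_left (d : T) hm)
      convert this using 1
      ring
  have ht : algebraMap T K (c * u) ∈ (star.cl (StarOperation.preimage K (pullbackProj M D)
      (pullbackProj_surjective M D) (scale y⁻¹ F))).1 := by
    refine StarOperation.mem_cl_of_mul_mem h fun x hx => ?_
    obtain ⟨r, rfl⟩ := NzFrac.mem_one.1 (hJ hx)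
    obtain ⟨δ, hδ⟩ := NzFrac.mem_one.1 (mem_scale.1 (hy (hF r hx)))
    obtain ⟨s, rfl⟩ := pullbackProj_surjective M D δ
    have hs := (hlift r s).1 hδ
    have hmem : c * u * r ∈ pullbackRing M D := (mem_pullbackRing_iff_of_sub_mem hs).2 s.2
    have e : algebraMap T K (c * u) * algebraMap (pullbackRing M D) K r =
        algebraMap (pullbackRing M D) K ⟨c * u * r, hmem⟩ := (map_mul (algebraMap T K) _ _).symm
    rw [e]
    refine StarOperation.algebraMap_mem_preimage.2 (mem_scale.2 ?_)
    rw [(hlift r ⟨c * u * r, hmem⟩).2 (by simp)]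
    simpa using hF r hx
  have htR : c * u ∈ pullbackRing M D := by
    refine algebraMap_mem_one_pullbackRing (K := K).1 ?_
    have hle : StarOperation.preimage K (pullbackProj M D) (pullbackProj_surjective M D)
        (scale y⁻¹ F) ≤ one :=
      StarOperation.preimage_le_iff.2 fun r _ => NzFrac.mem_one.2 ⟨r, rfl⟩
    exact star.cl_one.le (star.cl_mono _ _ hle ht)
  refine ⟨⟨c * u, htR⟩, ht, ?_⟩
  have := (hlift 1 ⟨c * u, htR⟩).2 (by simp)
  simpa using this

/-- Relations rc = sd in R survive reduction modulo M, so denominators of a/b reduce to denominators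
of φ(a)/φ(b). -/
theorem denominators_le_preimage {z : Kˣ} {α : Lˣ} {a b : pullbackRing M D}
    (hz : (z : K) = algebraMap T K a / algebraMap T K b)
    (hα : (α : L) = algebraMap D L (pullbackProj M D a) / algebraMap D L (pullbackProj M D b)) :
    denominators (pullbackRing M D) z ≤ StarOperation.preimage K (pullbackProj M D)
      (pullbackProj_surjective M D) (denominators D α) := by
  have ha0 : algebraMap T K a ≠ 0 := fun h => z.ne_zero (by rw [hz, h, zero_div])
  have hb0 : algebraMap T K b ≠ 0 := fun h => z.ne_zero (by rw [hz, h, div_zero])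
  have ha0' : algebraMap D L (pullbackProj M D a) ≠ 0 := fun h =>
    α.ne_zero (by rw [hα, h, zero_div])
  have hb0' : algebraMap D L (pullbackProj M D b) ≠ 0 := fun h =>
    α.ne_zero (by rw [hα, h, div_zero])
  have key : ∀ r s c d : pullbackRing M D, algebraMap T K d ≠ 0 →
      algebraMap D L (pullbackProj M D d) ≠ 0 →
      algebraMap T K s = algebraMap T K r * (algebraMap T K c / algebraMap T K d) →
      algebraMap D L (pullbackProj M D s) = algebraMap D L (pullbackProj M D r) *
        (algebraMap D L (pullbackProj M D c) / algebraMap D L (pullbackProj M D d)) := by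
    intro r s c d hd hd' h
    rw [← mul_div_assoc, eq_div_iff hd] at h
    rw [← mul_div_assoc, eq_div_iff hd', ← map_mul, ← map_mul, ← map_mul, ← map_mul]
    rw [← map_mul, ← map_mul] at h
    exact congrArg _ (congrArg _ (Subtype.ext (IsFractionRing.injective T K h)))
  refine Submodule.span_le.2 ?_
  rintro x ⟨hx, hxz⟩
  obtain ⟨r, rfl⟩ := NzFrac.mem_one.1 hx
  refine StarOperation.algebraMap_mem_preimage.2 (mem_denominators (NzFrac.mem_one.2 ⟨_, rfl⟩) ?_)
  refine hxz.imp (fun hxz => ?_) fun hxz => ?_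
  · obtain ⟨s, hs⟩ := NzFrac.mem_one.1 hxz
    rw [hz] at hs
    rw [hα]
    exact NzFrac.mem_one.2 ⟨_, key r s a b hb0 hb0' hs⟩
  · obtain ⟨s, hs⟩ := NzFrac.mem_one.1 hxz
    rw [hz, inv_div] at hs
    rw [hα, inv_div]
    exact NzFrac.mem_one.2 ⟨_, key r s b a ha0 ha0' hs⟩

/-- Lift α = φ(a)/φ(b) to z = a/b and push a finitely generated J ⊆ Q_R(z) forward along φ. Its
image is nonzero since J is not contained in M. -/
theorem isPStarMD_proj (hD : D ≠ ⊤) (h : star.IsPStarMD) :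
    (star.proj (pullbackProj M D) (pullbackProj_surjective M D) L).IsPStarMD := by
  refine StarOperation.isPStarMD_iff.2 fun α => ?_
  obtain ⟨a, b, hb, hα⟩ := IsFractionRing.div_surjective (A := D) (α : L)
  obtain ⟨a, rfl⟩ := pullbackProj_surjective M D a
  obtain ⟨b, rfl⟩ := pullbackProj_surjective M D b
  have hne : ∀ r : pullbackRing M D, pullbackProj M D r ≠ 0 → algebraMap T K r ≠ 0 := by
    intro r hr
    rw [Ne, FaithfulSMul.algebraMap_eq_zero_iff]
    rintro h0
    exact hr (pullbackProj_eq_zero_iff.2 (h0 ▸ M.zero_mem))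
  have ha0 : pullbackProj M D a ≠ 0 := fun h0 => α.ne_zero (by rw [← hα, h0]; simp)
  let z : Kˣ := Units.mk0 (algebraMap T K a / algebraMap T K b)
    (div_ne_zero (hne a ha0) (hne b (nonZeroDivisors.ne_zero hb)))
  have hle := denominators_le_preimage (z := z) (D := D) rfl hα.symm
  obtain ⟨J, hJfg, hJz, hJ⟩ := StarOperation.mem_finClosure.1 (StarOperation.isPStarMD_iff.1 h z)
  have hJ1 : J ≤ one := hJz.trans (denominators_le_one z)
  obtain ⟨r, hr, hrM⟩ := exists_notMem_of_one_mem_cl hD hJ1 hJ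
  have hsurj := pullbackProj_surjective M D
  have himg : StarOperation.image L (pullbackProj M D) J ≤ (denominators D α).1 := by
    intro x hx
    obtain ⟨s, hs, rfl⟩ := (StarOperation.mem_image hsurj).1 hx
    exact StarOperation.algebraMap_mem_preimage.1 (hle (hJz hs))
  have hr0 : algebraMap D L (pullbackProj M D r) ≠ 0 := by
    rw [Ne, map_eq_zero_iff _ (IsFractionRing.injective D L)]
    exact mt pullbackProj_eq_zero_iff.1 hrM
  refine ⟨⟨StarOperation.image L (pullbackProj M D) J, (Submodule.ne_bot_iff _).2
    ⟨_, (StarOperation.mem_image hsurj).2 ⟨r, hr, rfl⟩, hr0⟩,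
    isFractional_of_le himg (denominators D α).2.2⟩, image_fg L hJ1 hJfg, himg, ?_⟩
  exact one_mem_proj_cl hJ1 hJ fun s hs => (StarOperation.mem_image hsurj).2 ⟨s, hs, rfl⟩

/-- Only 1 ∈ E^{v_T} needs an argument. Let uE ⊆ T and take j ∈ J outside M with jw − 1 ∈ M. Then
(jw − 1)uJ ⊆ M ⊆ R gives (jw − 1)u ∈ R, and u = (uj)w − (jw − 1)u lies in T. -/
theorem one_mem_extend_cl (hD : D ≠ ⊤) {J : NzFrac (pullbackRing M D) K} (hJ : J ≤ one)
    (h : (1 : K) ∈ (star.cl J).1) {E : NzFrac T K} (hJE : (J.1 : Set K) ⊆ E.1) :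
    (1 : K) ∈ ((star.extend T (pullback_conductorNeZero M D)).cl E).1 := by
  refine ⟨star.cl_mono J (StarOperation.restrict _ E) hJE h, mem_inv.2 fun u hu => ?_⟩
  rw [mem_inv] at hu
  obtain ⟨j, hj, hjM⟩ := exists_notMem_of_one_mem_cl hD hJ h
  obtain ⟨w, hw⟩ := exists_mul_sub_one_mem hjM
  obtain ⟨p, hp⟩ := hu _ (hJE hj)
  have hm : algebraMap T K (j * w - 1) * u ∈ (one : NzFrac (pullbackRing M D) K).1 := by
    refine StarOperation.mem_one_of_mul_mem h fun y hy => ?_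
    obtain ⟨q, hq⟩ := hu _ (hJE hy)
    rw [mul_assoc, ← hq, ← map_mul]
    exact algebraMap_mem_one_pullbackRing.2 (mem_pullbackRing_of_mem M D (M.mul_mem_right q hw))
  obtain ⟨q, hq⟩ := NzFrac.mem_one.1 hm
  refine ⟨p * w - q, ?_⟩
  change algebraMap T K q = _ at hq
  rw [map_sub, map_mul, hp, hq, map_sub, map_mul, map_one]
  ring

theorem isPStarMD_extend (hD : D ≠ ⊤) (h : star.IsPStarMD) :
    (star.extend T (pullback_conductorNeZero M D)).IsPStarMD := by
  refine StarOperation.isPStarMD_iff.2 fun z => ?_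
  obtain ⟨J, hJfg, hJz, hJ⟩ := StarOperation.mem_finClosure.1 (StarOperation.isPStarMD_iff.1 h z)
  have hle : Submodule.span T (J.1 : Set K) ≤ (denominators T z).1 :=
    Submodule.span_le.2 fun x hx => denominators_subset z (hJz hx)
  obtain ⟨x, hx, hx0⟩ := J.exists_ne_zero
  have hfg : (Submodule.span T (J.1 : Set K)).FG := by
    obtain ⟨S, hS⟩ := hJfg
    rw [← hS, Submodule.span_span_of_tower]
    exact ⟨S, rfl⟩
  refine ⟨⟨Submodule.span T (J.1 : Set K),
    (Submodule.ne_bot_iff _).2 ⟨x, Submodule.subset_span hx, hx0⟩,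
    isFractional_of_le hle (denominators T z).2.2⟩, hfg, hle, ?_⟩
  exact one_mem_extend_cl hD (hJz.trans (denominators_le_one z)) hJ Submodule.subset_span

end Pullback

/-! ### Sufficiency: lifting ideals from D and from T to R. -/

/-- Lifts of generators generate the preimage up to the kernel. The kernel itself need not be
finitely generated, but it lies in (a, m) with a a lift already available and m one extra generator.
-/
theorem comap_fg_of_surjective {A B : Type*} [CommRing A] [CommRing B] {φ : A →+* B}
    (hφ : Function.Surjective φ)
    (hker : ∀ a, φ a ≠ 0 → ∃ m, φ m = 0 ∧ ∀ r, φ r = 0 → r ∈ Ideal.span {a, m})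
    {I : Ideal B} (hI : I.FG) (hI0 : I ≠ ⊥) : (I.comap φ).FG := by
  obtain ⟨S, hS⟩ := hI
  have hJ : (Ideal.span (Function.surjInv hφ '' S)).map φ = I := by
    rw [Ideal.map_span, Set.image_image, ← hS]
    simp only [Function.surjInv_eq, Set.image_id']
  obtain ⟨x, hx, hx0⟩ := Submodule.exists_mem_ne_zero_of_ne_bot hI0
  rw [← hJ, Ideal.mem_map_iff_of_surjective _ hφ] at hx
  obtain ⟨a, ha, rfl⟩ := hx
  obtain ⟨m, hm, hker⟩ := hker a hx0
  have hle : I.comap φ = Ideal.span (Function.surjInv hφ '' S) ⊔ Ideal.span {m} := by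
    apply le_antisymm
    · intro r hr
      rw [Ideal.mem_comap, ← hJ, Ideal.mem_map_iff_of_surjective _ hφ] at hr
      obtain ⟨j, hj, hjr⟩ := hr
      rw [← add_sub_cancel j r]
      refine Ideal.add_mem _ (Ideal.mem_sup_left hj)
        (SetLike.le_def.1 (Ideal.span_le.2 ?_) (hker _ (by rw [map_sub, hjr, sub_self])))
      rintro y (rfl | rfl)
      · exact Ideal.mem_sup_left ha
      · exact Ideal.mem_sup_right (Ideal.mem_span_singleton_self _)
    · refine sup_le (Ideal.map_le_iff_le_comap.1 hJ.le) ((Ideal.span_singleton_le_iff_mem _).2 ?_)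
      rw [Ideal.mem_comap, hm]
      exact I.zero_mem
  rw [hle]
  exact Submodule.FG.sup (Submodule.fg_span (S.finite_toSet.image _))
    (Submodule.fg_span_singleton m)

section Conductor

variable {T : Type*} [CommRing T] [IsDomain T] {K : Type*} [Field K] [Algebra T K]
  [IsFractionRing T K] {M : Ideal T} [NeZero M] {D : Subring (T ⧸ M)}

/-- This is M Q_T(z) ⊆ Q_R(z), a consequence of MT = M ⊆ R. -/
theorem mul_mem_denominators_of_mem {z : Kˣ} {x : K} (hx : x ∈ (denominators T z).1) {m : T}
    (hm : m ∈ M) : algebraMap T K m * x ∈ (denominators (pullbackRing M D) z).1 := by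
  have hmul : ∀ μ ∈ M, ∀ y ∈ (one : NzFrac T K).1,
      algebraMap T K μ * y ∈ (one : NzFrac (pullbackRing M D) K).1 := by
    intro μ hμ y hy
    obtain ⟨p, rfl⟩ := NzFrac.mem_one.1 hy
    rw [← map_mul]
    exact algebraMap_mem_one_pullbackRing.2 (mem_pullbackRing_of_mem M D (M.mul_mem_right p hμ))
  revert m
  induction hx using Submodule.span_induction with
  | zero => simp
  | add x y _ _ hx hy =>
    intro μ hμ
    rw [mul_add]
    exact Submodule.add_mem _ (hx hμ) (hy hμ)
  | smul a x _ hx =>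
    intro μ hμ
    rw [Algebra.smul_def, ← mul_assoc, ← map_mul]
    exact hx (M.mul_mem_right a hμ)
  | mem x hx =>
    intro μ hμ
    refine mem_denominators (hmul μ hμ x hx.1) ?_
    rw [mul_assoc, mul_assoc]
    exact hx.2.imp (hmul μ hμ _) (hmul μ hμ _)

end Conductor

section Pullback

variable {T : Type*} [CommRing T] {M : Ideal T} [hM : M.IsMaximal] {D : Subring (T ⧸ M)}

theorem comap_pullbackProj_fg {I : Ideal D} (hI : I.FG) (hI0 : I ≠ ⊥) :
    (I.comap (pullbackProj M D)).FG := by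
  refine comap_fg_of_surjective (pullbackProj_surjective M D) (fun a ha => ?_) hI hI0
  obtain ⟨t, ht⟩ := exists_mul_sub_one_mem (mt pullbackProj_eq_zero_iff.2 ha)
  -- For r ∈ M the identity r = (tr)a − r(at − 1) has coefficients in R, as tr ∈ M.
  refine ⟨⟨a * t - 1, mem_pullbackRing_of_mem M D ht⟩, pullbackProj_eq_zero_iff.2 ht,
    fun r hr => ?_⟩
  have hμ : (r : T) ∈ M := pullbackProj_eq_zero_iff.1 hr
  refine Ideal.mem_span_pair.2
    ⟨⟨t * r, mem_pullbackRing_of_mem M D (M.mul_mem_left t hμ)⟩, -r, Subtype.ext ?_⟩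
  push_cast
  ring

variable [IsDomain T] {K : Type*} [Field K] [Algebra T K] [IsFractionRing T K] [NeZero M]
  {L : Type*} [Field L] [Algebra D L] [IsFractionRing D L]
  {star : StarOperation (pullbackRing M D) K}

/-- The term y = 1 of the intersection gives an element of the closure of φ⁻¹(G) that is congruent
to 1 modulo M, and M ⊆ φ⁻¹(G). Finite type is preserved because φ⁻¹(G) is again finitely generated.
-/
theorem one_mem_finType_cl_preimage {F : NzFrac D L} (hF : F ≤ one)
    (h : (1 : L) ∈
      ((star.proj (pullbackProj M D) (pullbackProj_surjective M D) L).finType.cl F).1) :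
    (1 : K) ∈ (star.finType.cl (StarOperation.preimage K (pullbackProj M D)
      (pullbackProj_surjective M D) F)).1 := by
  obtain ⟨G, hGfg, hGF, hG⟩ := StarOperation.mem_finClosure.1 h
  refine StarOperation.mem_finClosure.2 ⟨StarOperation.preimage K (pullbackProj M D)
    (pullbackProj_surjective M D) G, ?_, StarOperation.preimage_le_iff.2 fun r hr =>
      StarOperation.algebraMap_mem_preimage.2 (hGF hr), ?_⟩
  · refine Submodule.FG.map _ (comap_pullbackProj_fg ?_ ?_)
    · refine Submodule.fg_of_fg_map_injective (Algebra.linearMap D L)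
        (IsFractionRing.injective D L) ?_
      rwa [Submodule.map_comap_eq_of_le]
      intro x hx
      obtain ⟨a, rfl⟩ := NzFrac.mem_one.1 (hF (hGF hx))
      exact ⟨a, rfl⟩
    · obtain ⟨x, hx, hx0⟩ := G.exists_ne_zero
      obtain ⟨a, rfl⟩ := NzFrac.mem_one.1 (hF (hGF hx))
      exact (Submodule.ne_bot_iff _).2 ⟨a, hx, fun h0 => hx0 (by rw [h0, map_zero])⟩
  · obtain ⟨r, hr, hr1⟩ := StarOperation.mem_projSubmodule.1 hG 1
      (by rw [scale_one]; exact hGF.trans hF)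
    rw [inv_one, scale_one] at hr
    rw [Units.val_one, inv_one, one_mul, ← map_one (algebraMap D L),
      (IsFractionRing.injective D L).eq_iff] at hr1
    have h1 : algebraMap (pullbackRing M D) K (1 - r) ∈ (star.cl (StarOperation.preimage K
        (pullbackProj M D) (pullbackProj_surjective M D) G)).1 := by
      refine star.le_cl _ (StarOperation.algebraMap_mem_preimage.2 ?_)
      rw [map_sub, hr1, map_one, sub_self, map_zero]
      exact Submodule.zero_mem _
    have := Submodule.add_mem _ h1 hr
    rwa [map_sub, sub_add_cancel, map_one] at this

/-- H is not contained in M, so it contains some h ≡ 1 modulo M, and h ∈ R. Take J generated over R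
by h and (h − 1)S, where S generates H over T. Then MH ⊆ J, so (h − 1)H ⊆ J gives h − 1 ∈ J^∗, and 1
= h − (h − 1). -/
theorem exists_fg_of_one_mem_extend_cl (hD : D ≠ ⊤) {H : NzFrac T K} (hfg : H.1.FG)
    (hH : H ≤ one)
    (h : (1 : K) ∈ ((star.extend T (pullback_conductorNeZero M D)).cl H).1) :
    ∃ J : NzFrac (pullbackRing M D) K, J.1.FG ∧ J ≤ one ∧ (J.1 : Set K) ⊆ H.1 ∧
      (1 : K) ∈ (star.cl J).1 := by
  obtain ⟨S, hS⟩ := hfg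
  have hcl : (1 : K) ∈ (star.cl (StarOperation.restrict _ H)).1 := h.1
  obtain ⟨x, hx, hxM⟩ := not_le_of_one_mem_cl hD hcl
  have hxH : x ∈ H.1 := hx
  obtain ⟨t, rfl⟩ := NzFrac.mem_one.1 (hH hxH)
  obtain ⟨u, hu⟩ := exists_mul_sub_one_mem fun ht => hxM t ht rfl
  have hh : algebraMap T K (t * u) ∈ H.1 := by
    rw [mul_comm, map_mul, ← Algebra.smul_def]
    exact H.1.smul_mem u hxH
  have hhR : algebraMap T K (t * u) ∈ (one : NzFrac (pullbackRing M D) K).1 :=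
    algebraMap_mem_one_pullbackRing.2 (mem_pullbackRing_of_sub_one_mem hu)
  have hMone : ∀ μ ∈ M, ∀ y ∈ H.1,
      algebraMap T K μ * y ∈ (one : NzFrac (pullbackRing M D) K).1 := by
    intro μ hμ y hy
    obtain ⟨p, rfl⟩ := NzFrac.mem_one.1 (hH hy)
    rw [← map_mul]
    exact algebraMap_mem_one_pullbackRing.2 (mem_pullbackRing_of_mem M D (M.mul_mem_right p hμ))
  have hSH : ∀ y ∈ S, y ∈ H.1 := fun y hy => by
    rw [← hS]
    exact Submodule.subset_span hy
  let G : Set K := insert (algebraMap T K (t * u)) ((algebraMap T K (t * u - 1) * ·) '' S)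
  have hGone : Submodule.span (pullbackRing M D) G ≤ (one : NzFrac (pullbackRing M D) K).1 := by
    refine Submodule.span_le.2 (Set.insert_subset hhR ?_)
    rintro _ ⟨y, hy, rfl⟩
    exact hMone _ hu y (hSH y hy)
  have hGH : Submodule.span (pullbackRing M D) G ≤ H.1.restrictScalars (pullbackRing M D) := by
    refine Submodule.span_le.2 (Set.insert_subset hh ?_)
    rintro _ ⟨y, hy, rfl⟩
    simpa [Algebra.smul_def] using H.1.smul_mem (t * u - 1) (hSH y hy)
  let J : NzFrac (pullbackRing M D) K := ⟨Submodule.span (pullbackRing M D) G,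
    (Submodule.ne_bot_iff _).2 ⟨_, Submodule.subset_span (Set.mem_insert _ _), by
      rw [Ne, map_eq_zero_iff _ (IsFractionRing.injective T K)]
      exact fun h0 => notMem_of_sub_one_mem hu (h0 ▸ M.zero_mem)⟩,
    isFractional_of_le hGone (one : NzFrac (pullbackRing M D) K).2.2⟩
  have hhJ : algebraMap T K (t * u) ∈ J.1 := Submodule.subset_span (Set.mem_insert _ _)
  have hMH : ∀ y ∈ H.1, ∀ μ ∈ M, algebraMap T K μ * y ∈ J.1 := by
    intro y hy
    rw [← hS] at hy
    induction hy using Submodule.span_induction with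
    | zero => simp
    | add x y _ _ hx hy =>
      intro μ hμ
      rw [mul_add]
      exact Submodule.add_mem _ (hx μ hμ) (hy μ hμ)
    | smul a x _ hx =>
      intro μ hμ
      rw [Algebra.smul_def, ← mul_assoc, ← map_mul]
      exact hx _ (M.mul_mem_right a hμ)
    | mem y hy =>
      intro μ hμ
      -- With h = tu, this uses μy = (μy)h − μ(h − 1)y, where μy and μ lie in R.
      have h1 := one_mul_mem (hMone μ hμ y (hSH y hy)) hhJ
      have h2 : algebraMap T K (t * u - 1) * y ∈ J.1 :=
        Submodule.subset_span (Set.mem_insert_of_mem _ ⟨y, hy, rfl⟩)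
      have h3 := one_mul_mem (algebraMap_mem_one_pullbackRing (K := K).2
        (mem_pullbackRing_of_mem M D hμ)) h2
      convert Submodule.sub_mem _ h1 h3 using 1
      rw [map_sub, map_one]
      ring
  refine ⟨J, Submodule.fg_span ((S.finite_toSet.image _).insert _), hGone, hGH, ?_⟩
  have h1 : algebraMap T K (t * u - 1) ∈ (star.cl J).1 :=
    StarOperation.mem_cl_of_mul_mem hcl fun y hy => hMH y hy _ hu
  have := Submodule.sub_mem _ (star.le_cl J hhJ) h1
  simpa using this

/-- If the image of `z = t / s` in `T / M` is a quotient `α` of elements of `D`, then every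
element of `R` whose image lies in `(D : α) + (D : α⁻¹)` is congruent modulo `M` to an element
of `(R : z) + (R : z⁻¹)`. -/
theorem exists_sub_mem_of_mem_denominators {z : Kˣ} {s t : T} (hs : s ∉ M) (ht : t ∉ M)
    (hz : algebraMap T K s * z = algebraMap T K t) {α : Lˣ} {a b : pullbackRing M D}
    (ha : (a : T) ∉ M) (hb : (b : T) ∉ M) (hab : t * b - s * a ∈ M)
    (hα : algebraMap D L (pullbackProj M D b) * α = algebraMap D L (pullbackProj M D a))
    {d : pullbackRing M D} (hd : algebraMap D L (pullbackProj M D d) ∈ (denominators D α).1) :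
    ∃ c : pullbackRing M D, algebraMap T K c ∈ (denominators (pullbackRing M D) z).1 ∧
      (d : T) - c ∈ M := by
  have hsurj := pullbackProj_surjective M D
  have hα' : algebraMap D L (pullbackProj M D a) * (α : L)⁻¹ =
      algebraMap D L (pullbackProj M D b) := by
    rw [← hα, mul_inv_cancel_right₀ α.ne_zero]
  have hz' : algebraMap T K t * (z : K)⁻¹ = algebraMap T K s := by
    rw [← hz, mul_inv_cancel_right₀ z.ne_zero]
  -- Stated for a general pair (w, β) so as to apply to (z, α) and to (z⁻¹, α⁻¹). With v inverse to
  -- p modulo M, the element c = pvd is congruent to d, and cw = qvd is congruent to a lift of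
  -- φ(d)β, hence lies in R.
  have key : ∀ (w : K) (β : L) (p q : T) (f g : pullbackRing M D), p ∉ M → (g : T) ∉ M →
      algebraMap T K p * w = algebraMap T K q →
      q * g - p * f ∈ M →
      algebraMap D L (pullbackProj M D g) * β = algebraMap D L (pullbackProj M D f) →
      ∀ d : pullbackRing M D, algebraMap D L (pullbackProj M D d) * β ∈ (one : NzFrac D L).1 →
      ∃ c : pullbackRing M D, (d : T) - c ∈ M ∧
        algebraMap T K c * w ∈ (one : NzFrac (pullbackRing M D) K).1 := by
    intro w β p q f g hp hg hw hqg hβ d hd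
    obtain ⟨r, hr⟩ := NzFrac.mem_one.1 hd
    obtain ⟨r, rfl⟩ := hsurj r
    have hrd : (d * f : T) - r * g ∈ M := by
      refine pullbackProj_eq_iff (D := D) (a := d * f) (b := r * g).1
        (IsFractionRing.injective D L ?_)
      rw [map_mul, map_mul, map_mul, map_mul, ← hβ, hr]
      ring
    obtain ⟨v, hv⟩ := exists_mul_sub_one_mem hp
    have hvd : (d : T) - p * v * d ∈ M := by
      convert M.mul_mem_left (-d : T) hv using 1
      ring
    refine ⟨⟨p * v * d, (mem_pullbackRing_iff_of_sub_mem hvd).1 d.2⟩, hvd, ?_⟩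
    have e : algebraMap T K (p * v * d) * w = algebraMap T K (q * v * d) := by
      rw [map_mul, map_mul, map_mul, map_mul, ← hw]
      ring
    rw [e]
    refine algebraMap_mem_one_pullbackRing.2 ((mem_pullbackRing_iff_of_sub_mem (b := (r : T)) ?_).2
      r.2)
    refine (hM.isPrime.mem_or_mem (x := q * v * d - r) (y := (g : T)) ?_).resolve_right hg
    have := M.add_mem (M.add_mem (M.mul_mem_left (v * d) hqg) (M.mul_mem_left (d * f) hv)) hrd
    convert this using 1
    ring
  have hle : (denominators D α).1 ≤ StarOperation.image L (pullbackProj M D)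
      (denominators (pullbackRing M D) z) := by
    refine Submodule.span_le.2 ?_
    rintro x ⟨hx, hxα⟩
    obtain ⟨d, rfl⟩ := NzFrac.mem_one.1 hx
    obtain ⟨d, rfl⟩ := hsurj d
    refine (StarOperation.mem_image hsurj).2 ?_
    rcases hxα with hxα | hxα
    · obtain ⟨c, hc, hcz⟩ := key z α s t a b hs hb hz hab hα d hxα
      exact ⟨c, mem_denominators (NzFrac.mem_one.2 ⟨c, rfl⟩) (Or.inl hcz),
        congrArg _ (pullbackProj_eq_iff.2 hc).symm⟩
    · obtain ⟨c, hc, hcz⟩ := key _ _ t s b a ht ha hz'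
        (by convert M.neg_mem hab using 1; ring) hα' d hxα
      exact ⟨c, mem_denominators (NzFrac.mem_one.2 ⟨c, rfl⟩) (Or.inr hcz),
        congrArg _ (pullbackProj_eq_iff.2 hc).symm⟩
  obtain ⟨c, hc, hcd⟩ := (StarOperation.mem_image hsurj).1 (hle hd)
  exact ⟨c, hc, pullbackProj_eq_iff.1 (IsFractionRing.injective D L hcd).symm⟩

/-- Here z = t/s is a local element at M. If its residue is nonzero, it is a fraction α over D, and
J is the preimage of Q_D(α). If its residue is zero, J = R already works. -/
theorem exists_one_mem_finType_cl [IsFractionRing D (T ⧸ M)]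
    (hPD : (star.proj (pullbackProj M D) (pullbackProj_surjective M D) L).IsPStarMD)
    {z : Kˣ} {s t : T} (hs : s ∉ M) (hz : algebraMap T K s * z = algebraMap T K t) :
    ∃ J : NzFrac (pullbackRing M D) K, (1 : K) ∈ (star.finType.cl J).1 ∧
      ∀ x ∈ J.1, ∃ c ∈ (denominators (pullbackRing M D) z).1, ∃ m ∈ M,
        x = c + algebraMap T K m := by
  by_cases ht : t ∈ M
  · obtain ⟨u, hu⟩ := exists_mul_sub_one_mem hs
    have h1 : (1 : K) ∈ (one : NzFrac (pullbackRing M D) K).1 := NzFrac.mem_one.2 ⟨1, map_one _⟩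
    refine ⟨one, star.finType.le_cl _ h1, fun x hx => ?_⟩
    obtain ⟨r, rfl⟩ := NzFrac.mem_one.1 hx
    -- With su ≡ 1 modulo M, su lies in (R : z) because (su)z = tu ∈ M; so r differs from r(su) ∈
    -- Q_R(z) by an element of M.
    refine ⟨_, Submodule.smul_mem _ r (mem_denominators (x := algebraMap T K (s * u))
      (algebraMap_mem_one_pullbackRing.2 (mem_pullbackRing_of_sub_one_mem hu)) (Or.inl ?_)),
      _, M.neg_mem (M.mul_mem_left (r : T) hu), ?_⟩
    · rw [map_mul, mul_right_comm, hz, ← map_mul]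
      exact algebraMap_mem_one_pullbackRing.2 (mem_pullbackRing_of_mem M D (M.mul_mem_right u ht))
    · rw [Algebra.smul_def]
      change algebraMap T K r = algebraMap T K r * algebraMap T K (s * u) + _
      rw [← map_mul, ← map_add]
      congr 1
      ring
  · let := Ideal.Quotient.field M
    obtain ⟨a, b, hb, hab⟩ := IsFractionRing.div_surjective (A := D)
      (Ideal.Quotient.mk M t / Ideal.Quotient.mk M s)
    obtain ⟨a, rfl⟩ := pullbackProj_surjective M D a
    obtain ⟨b, rfl⟩ := pullbackProj_surjective M D b
    have hbM : (b : T) ∉ M := mt pullbackProj_eq_zero_iff.2 (nonZeroDivisors.ne_zero hb)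
    have hs0 : Ideal.Quotient.mk M s ≠ 0 := mt Ideal.Quotient.eq_zero_iff_mem.1 hs
    have hb0 : Ideal.Quotient.mk M b ≠ 0 := mt Ideal.Quotient.eq_zero_iff_mem.1 hbM
    have habM : t * b - s * a ∈ M := by
      change Ideal.Quotient.mk M a / Ideal.Quotient.mk M b = _ at hab
      rw [div_eq_div_iff hb0 hs0] at hab
      rw [← Ideal.Quotient.eq, map_mul, map_mul, ← hab, mul_comm]
    have haM : (a : T) ∉ M := fun ha => by
      have := M.add_mem habM (M.mul_mem_left s ha)
      rw [sub_add_cancel] at this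
      exact (hM.isPrime.mem_or_mem this).elim ht hbM
    have hne : ∀ r : pullbackRing M D, (r : T) ∉ M → algebraMap D L (pullbackProj M D r) ≠ 0 := by
      intro r hr
      rw [Ne, map_eq_zero_iff _ (IsFractionRing.injective D L)]
      exact mt pullbackProj_eq_zero_iff.1 hr
    let α : Lˣ := Units.mk0 (algebraMap D L (pullbackProj M D a) /
      algebraMap D L (pullbackProj M D b)) (div_ne_zero (hne a haM) (hne b hbM))
    have hα : algebraMap D L (pullbackProj M D b) * α = algebraMap D L (pullbackProj M D a) :=
      mul_div_cancel₀ _ (hne b hbM)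
    refine ⟨_, one_mem_finType_cl_preimage (denominators_le_one α)
      (StarOperation.isPStarMD_iff.1 hPD α), fun x hx => ?_⟩
    obtain ⟨d, hd, rfl⟩ := (IsLocalization.mem_coeSubmodule K _).1 hx
    obtain ⟨c, hc, hdc⟩ := exists_sub_mem_of_mem_denominators hs ht hz haM hbM habM hα hd
    refine ⟨_, hc, _, hdc, ?_⟩
    rw [← map_add, add_sub_cancel]
    rfl

/-- As T_M is a valuation domain, z or z⁻¹ has a denominator outside M, and Q_R(z) = Q_R(z⁻¹). -/
theorem exists_one_mem_finType_cl_of_valuationRing [IsFractionRing D (T ⧸ M)]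
    (hPD : (star.proj (pullbackProj M D) (pullbackProj_surjective M D) L).IsPStarMD)
    (hval : ValuationRing (Localization.AtPrime M)) (z : Kˣ) :
    ∃ J : NzFrac (pullbackRing M D) K, (1 : K) ∈ (star.finType.cl J).1 ∧
      ∀ x ∈ J.1, ∃ c ∈ (denominators (pullbackRing M D) z).1, ∃ m ∈ M,
        x = c + algebraMap T K m := by
  obtain ⟨a, b, hb, hab⟩ := IsFractionRing.div_surjective (A := T) (z : K)
  have hb0 : algebraMap T K b ≠ 0 := IsFractionRing.to_map_ne_zero_of_mem_nonZeroDivisors hb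
  have ha0 : algebraMap T K a ≠ 0 := fun h => z.ne_zero (by rw [← hab, h, zero_div])
  obtain ⟨s, hs, c, hc | hc⟩ := valuationRing_atPrime_iff.1 hval a b
  · refine exists_one_mem_finType_cl hPD (t := c) hs ?_
    rw [← hab, ← mul_div_assoc, div_eq_iff hb0, ← map_mul, hc, map_mul]
  · rw [← denominators_inv]
    refine exists_one_mem_finType_cl hPD (t := c) hs ?_
    rw [Units.val_inv_eq_inv_val, ← hab, inv_div, ← mul_div_assoc, div_eq_iff ha0, ← map_mul, hc,
      map_mul]

theorem isPStarMD_of_proj_of_extend (hD : D ≠ ⊤) [IsFractionRing D (T ⧸ M)]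
    (hPD : (star.proj (pullbackProj M D) (pullbackProj_surjective M D) L).IsPStarMD)
    (hPT : (star.extend T (pullback_conductorNeZero M D)).IsPStarMD)
    (hval : ValuationRing (Localization.AtPrime M)) : star.IsPStarMD := by
  refine StarOperation.isPStarMD_iff.2 fun z => ?_
  obtain ⟨J₂, hJ₂, hJ₂z⟩ := exists_one_mem_finType_cl_of_valuationRing hPD hval z
  obtain ⟨H, hHfg, hHz, hH⟩ := StarOperation.mem_finClosure.1 (StarOperation.isPStarMD_iff.1 hPT z)
  obtain ⟨J, hJfg, hJ1, hJH, hJ⟩ :=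
    exists_fg_of_one_mem_extend_cl hD hHfg (hHz.trans (denominators_le_one z)) hH
  have hJ' : (1 : K) ∈ (star.finType.cl J).1 :=
    StarOperation.mem_finClosure.2 ⟨J, hJfg, le_rfl, hJ⟩
  refine StarOperation.one_mem_cl_of_le_cl hJ' fun x hx => ?_
  refine StarOperation.mem_cl_of_mul_mem hJ₂ fun y hy => ?_
  obtain ⟨c, hc, m, hm, rfl⟩ := hJ₂z y hy
  rw [mul_add, mul_comm x (algebraMap T K m)]
  exact Submodule.add_mem _ (one_mul_mem (hJ1 hx) hc)
    (mul_mem_denominators_of_mem (hHz (hJH hx)) hm)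

end Pullback

end StarOp

theorem mainTheorem5 {T : Type*} [CommRing T] [IsDomain T] {K : Type*} [Field K] [Algebra T K]
    [IsFractionRing T K] (M : Ideal T) [M.IsMaximal] [NeZero M]
    (D : Subring (T ⧸ M)) (hD : D ≠ ⊤)
    (L : Type*) [Field L] [Algebra D L] [IsFractionRing D L]
    (star : StarOp.StarOperation (StarOp.pullbackRing M D) K) :
    star.IsPStarMD ↔
      IsFractionRing D (T ⧸ M) ∧
      (star.proj (StarOp.pullbackProj M D) (StarOp.pullbackProj_surjective M D) L).IsPStarMD ∧
      (star.extend T (StarOp.pullback_conductorNeZero M D)).IsPStarMD ∧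
      ValuationRing (Localization.AtPrime M) :=
  ⟨fun h => ⟨StarOp.isFractionRing_of_isPStarMD hD h, StarOp.isPStarMD_proj hD h,
    StarOp.isPStarMD_extend hD h, StarOp.valuationRing_of_isPStarMD hD h⟩,
    fun ⟨_, hPD, hPT, hval⟩ => StarOp.isPStarMD_of_proj_of_extend hD hPD hPT hval⟩
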